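/- Let $(M,\phi,\xi,\eta,g_M)$ be a Sasakian manifold, i.e. $g_M$ is a Riemannian metric, $\phi$ a $(1,1)$-tensor field, $\xi$ a vector field and $\eta$ a $1$-form (all smooth) with $$\phi\xi=0,\quad \eta\circ\phi=0,\quad \eta(\xi)=1,\quad \phi^2=-I+\eta\otimes\xi,\quad g_M(\phi X,\phi Y)=g_M(X,Y)-\eta(X)\eta(Y),$$ $$(\nabla_X\phi)Y=-g_M(X,Y)\xi+\eta(Y)X,\qquad \nabla_X\xi=\phi X$$ for all vector fields $X,Y$, where $\nabla$ is the Levi-Civita connection of $g_M$. Let $(N,g_N)$ be a Riemannian manifold and let $\pi:M\to N$ be a conformal anti-invariant $\xi^\perp$-submersion with dilation $\lambda$; that is, $\pi$ is a smooth submersion, $\lambda:M\to(0,\infty)$ satisfies $\lambda^2 g_M(X,Y)=g_N(\pi_*X,\pi_*Y)$ for all horizontal $X,Y$ (i.e. $X,Y\in(\ker\pi_*)^\perp$), $\xi$ is orthogonal to $\ker\pi_*$, and $\phi(\ker\pi_*)\subset(\ker\pi_*)^\perp$. Let $\mu$ be the orthogonal complement of $\phi(\ker\pi_*)$ in $(\ker\pi_*)^\perp$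 and, for horizontal $X$, write $\phi X=\mathcal BX+\mathcal CX$ with $\mathcal BX\in\ker\pi_*$ and $\mathcal CX\in\mu$. Let $\mathcal V,\mathcal H$ be the orthogonal projections of $TM$ onto $\ker\pi_*$ and $(\ker\pi_*)^\perp$, let $A_EF=\mathcal V\nabla_{\mathcal HE}\mathcal HF+\mathcal H\nabla_{\mathcal HE}\mathcal VF$ be O'Neill's tensor, and let $\nabla^\pi$ be the pullback to $\pi^{-1}TN$ of the Levi-Civita connection of $g_N$. Then the following are equivalent: (a) the distribution $(\ker\pi_*)^\perp$ is integrable, i.e. $[X,Y]$ is horizontal for all smooth horizontal vector fields $X,Y$; (b) for all smooth horizontal vector fields $X,Y$ and all smooth vertical vector fields $V$ (i.e. $V\in\Gamma(\ker\pi_*)$), $$\begin{aligned}\frac1{\lambda^2}\,g_N\big(\nabla^\pi_Y\pi_*\mathcal CX-\nabla^\pi_X\pi_*\mathcal CY,\ \pi_*\phi V\big)=g_M\big(&A_X\mathcal BY-A_Y\mathcal BX-\mathcal CY(\ln\lambda)\,X+\mathcal CX(\ln\lambda)\,Y\\&-2g_M(\mathcal CX,Y)\,\mathrm{grad}\ln\lambda-\eta(Y)X+\eta(X)Y,\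 \phi V\big).\end{aligned}$$ -/

import Mathlib

open Bundle Manifold VectorField
open scoped ContDiff InnerProductSpace

noncomputable section

/-! ### Riemannian geometry: gradient and Levi-Civita connection

Manifolds are smooth, finite-dimensional and without boundary, modelled on `E` (or `F`); the
Riemannian metric is given by Mathlib's `RiemannianBundle` structure on the tangent bundle. -/

section Riemannian

variable {E : Type*} [NormedAddCommGroup E] [NormedSpace ℝ E]
  {M : Type*} [TopologicalSpace M] [ChartedSpace E M]

instance tangentSpace_finiteDimensional [FiniteDimensional ℝ E] (x : M) :
    FiniteDimensional ℝ (TangentSpace 𝓘(ℝ, E) x) :=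
  inferInstanceAs (FiniteDimensional ℝ E)

/-- `X` is a smooth vector field on `M`. -/
def IsSmoothField [IsManifold 𝓘(ℝ, E) ∞ M] (X : ∀ x : M, TangentSpace 𝓘(ℝ, E) x) : Prop :=
  ContMDiff 𝓘(ℝ, E) (𝓘(ℝ, E).prod 𝓘(ℝ, E)) ∞ (fun x : M => (⟨x, X x⟩ : TangentBundle 𝓘(ℝ, E) M))

/-- The derivative `v(u)` of a real function `u` along the tangent vector `v` at `x`. -/
def dirDeriv (u : M → ℝ) (x : M) (v : TangentSpace 𝓘(ℝ, E) x) : ℝ :=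
  mvfderiv 𝓘(ℝ, E) u x v

variable [RiemannianBundle (fun x : M => TangentSpace 𝓘(ℝ, E) x)]

/-- The right-hand side of the Koszul formula, that is `g(∇_X Y, Z)` at `x`. -/
def koszul (X Y Z : ∀ x : M, TangentSpace 𝓘(ℝ, E) x) (x : M) : ℝ :=
  (1 / 2) * (dirDeriv (fun y => ⟪Y y, Z y⟫_ℝ) x (X x)
    + dirDeriv (fun y => ⟪X y, Z y⟫_ℝ) x (Y x)
    - dirDeriv (fun y => ⟪X y, Y y⟫_ℝ) x (Z x)
    + ⟪mlieBracket 𝓘(ℝ, E) X Y x, Z x⟫_ℝ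
    - ⟪mlieBracket 𝓘(ℝ, E) X Z x, Y x⟫_ℝ
    - ⟪mlieBracket 𝓘(ℝ, E) Y Z x, X x⟫_ℝ)

variable [FiniteDimensional ℝ E]

/-- The gradient of a real function. -/
def riemGrad (u : M → ℝ) (x : M) : TangentSpace 𝓘(ℝ, E) x :=
  (InnerProductSpace.toDual ℝ (TangentSpace 𝓘(ℝ, E) x)).symm (mvfderiv 𝓘(ℝ, E) u x)

variable [IsManifold 𝓘(ℝ, E) ∞ M]

/-- The Levi-Civita connection: `leviCivita Y x v` is `∇_v Y`, for `v` tangent at `x`. It is the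
vector whose inner products with an orthonormal basis of the tangent space at `x` are given by
the Koszul formula; the formula is tensorial in `X` and `Z`, so that tangent vectors may be
extended to vector fields in any way (`FiberBundle.extend` is constant in the preferred
trivialization at `x`). -/
def leviCivita (Y : ∀ x : M, TangentSpace 𝓘(ℝ, E) x) (x : M) (v : TangentSpace 𝓘(ℝ, E) x) :
    TangentSpace 𝓘(ℝ, E) x :=
  ∑ i, koszul (FiberBundle.extend E v) Y
    (FiberBundle.extend E (stdOrthonormalBasis ℝ (TangentSpace 𝓘(ℝ, E) x) i)) x •
      stdOrthonormalBasis ℝ (TangentSpace 𝓘(ℝ, E) x) i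

end Riemannian

/-! ### Almost contact metric and Sasakian structures -/

section Contact

variable {E : Type*} [NormedAddCommGroup E] [NormedSpace ℝ E]
  {M : Type*} [TopologicalSpace M] [ChartedSpace E M]
  [IsManifold 𝓘(ℝ, E) ∞ M] [RiemannianBundle (fun x : M => TangentSpace 𝓘(ℝ, E) x)]

/-- `(φ, ξ, η)` and the given Riemannian metric form an almost contact metric structure. -/
structure IsAlmostContactMetric
    (φ : ∀ x : M, TangentSpace 𝓘(ℝ, E) x →L[ℝ] TangentSpace 𝓘(ℝ, E) x)
    (ξ : ∀ x : M, TangentSpace 𝓘(ℝ, E) x)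
    (η : ∀ x : M, TangentSpace 𝓘(ℝ, E) x →L[ℝ] ℝ) : Prop where
  smooth_phi : ContMDiff 𝓘(ℝ, E) (𝓘(ℝ, E).prod 𝓘(ℝ, E →L[ℝ] E)) ∞
    (fun x : M => TotalSpace.mk' (E →L[ℝ] E)
      (E := fun x : M => TangentSpace 𝓘(ℝ, E) x →L[ℝ] TangentSpace 𝓘(ℝ, E) x) x (φ x))
  smooth_xi : IsSmoothField ξ
  smooth_eta : ContMDiff 𝓘(ℝ, E) (𝓘(ℝ, E).prod 𝓘(ℝ, E →L[ℝ] ℝ)) ∞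
    (fun x : M => TotalSpace.mk' (E →L[ℝ] ℝ)
      (E := fun x : M => TangentSpace 𝓘(ℝ, E) x →L[ℝ] Bundle.Trivial M ℝ x) x (η x))
  phi_xi : ∀ x, φ x (ξ x) = 0
  eta_phi : ∀ x v, η x (φ x v) = 0
  eta_xi : ∀ x, η x (ξ x) = 1
  phi_phi : ∀ x v, φ x (φ x v) = -v + η x v • ξ x
  inner_phi_phi : ∀ x v w, ⟪φ x v, φ x w⟫_ℝ = ⟪v, w⟫_ℝ - η x v * η x w

/-- `(φ, ξ, η)` and the given Riemannian metric form a Sasakian structure, with the sign convention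
`(∇_X φ) Y = - g(X, Y) ξ + η(Y) X` and `∇_X ξ = φ X`. -/
structure IsSasakian [FiniteDimensional ℝ E]
    (φ : ∀ x : M, TangentSpace 𝓘(ℝ, E) x →L[ℝ] TangentSpace 𝓘(ℝ, E) x)
    (ξ : ∀ x : M, TangentSpace 𝓘(ℝ, E) x)
    (η : ∀ x : M, TangentSpace 𝓘(ℝ, E) x →L[ℝ] ℝ) : Prop extends
    IsAlmostContactMetric φ ξ η where
  nabla_phi : ∀ X Y : (∀ x : M, TangentSpace 𝓘(ℝ, E) x), IsSmoothField X → IsSmoothField Y →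
    ∀ x, leviCivita (fun y => φ y (Y y)) x (X x) - φ x (leviCivita Y x (X x))
      = -(⟪X x, Y x⟫_ℝ • ξ x) + η x (Y x) • X x
  nabla_xi : ∀ X : (∀ x : M, TangentSpace 𝓘(ℝ, E) x), IsSmoothField X →
    ∀ x, leviCivita ξ x (X x) = φ x (X x)

end Contact

/-! ### Conformal submersions -/

section Submersion

variable {E : Type*} [NormedAddCommGroup E] [NormedSpace ℝ E] [FiniteDimensional ℝ E]
  {M : Type*} [TopologicalSpace M] [ChartedSpace E M]
  {F : Type*} [NormedAddCommGroup F] [NormedSpace ℝ F]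
  {N : Type*} [TopologicalSpace N] [ChartedSpace F N]

/-- The vertical space `ker f_*` at `x`. -/
def vertSpace (f : M → N) (x : M) : Submodule ℝ (TangentSpace 𝓘(ℝ, E) x) :=
  LinearMap.ker (mfderiv 𝓘(ℝ, E) 𝓘(ℝ, F) f x).toLinearMap

variable [RiemannianBundle (fun x : M => TangentSpace 𝓘(ℝ, E) x)]

/-- The horizontal space `(ker f_*)ᗮ` at `x`. -/
def horSpace (f : M → N) (x : M) : Submodule ℝ (TangentSpace 𝓘(ℝ, E) x) :=
  (vertSpace (F := F) f x)ᗮ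

/-- The vertical projection `𝓥`. -/
def vert (f : M → N) (x : M) (v : TangentSpace 𝓘(ℝ, E) x) : TangentSpace 𝓘(ℝ, E) x :=
  (vertSpace (F := F) f x).starProjection v

/-- The horizontal projection `𝓗`. -/
def hor (f : M → N) (x : M) (v : TangentSpace 𝓘(ℝ, E) x) : TangentSpace 𝓘(ℝ, E) x :=
  (horSpace (F := F) f x).starProjection v

/-- The space `μ` at `x`: the orthogonal complement of `φ (ker f_*)` in `(ker f_*)ᗮ`. -/
def muSpace (φ : ∀ x : M, TangentSpace 𝓘(ℝ, E) x →L[ℝ] TangentSpace 𝓘(ℝ, E) x) (f : M → N)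
    (x : M) : Submodule ℝ (TangentSpace 𝓘(ℝ, E) x) :=
  horSpace (F := F) f x ⊓ ((vertSpace (F := F) f x).map (φ x).toLinearMap)ᗮ

/-- The component `𝓑 X` in `ker f_*` of the vector field `φ X`. -/
def compB (φ : ∀ x : M, TangentSpace 𝓘(ℝ, E) x →L[ℝ] TangentSpace 𝓘(ℝ, E) x) (f : M → N)
    (X : ∀ x : M, TangentSpace 𝓘(ℝ, E) x) (x : M) : TangentSpace 𝓘(ℝ, E) x :=
  (vertSpace (F := F) f x).starProjection (φ x (X x))

/-- The component `𝓒 X` in `μ` of the vector field `φ X`. -/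
def compC (φ : ∀ x : M, TangentSpace 𝓘(ℝ, E) x →L[ℝ] TangentSpace 𝓘(ℝ, E) x) (f : M → N)
    (X : ∀ x : M, TangentSpace 𝓘(ℝ, E) x) (x : M) : TangentSpace 𝓘(ℝ, E) x :=
  (muSpace (F := F) φ f x).starProjection (φ x (X x))

variable [IsManifold 𝓘(ℝ, E) ∞ M]

/-- `V` is a smooth vertical vector field. -/
def IsVerticalField (f : M → N) (V : ∀ x : M, TangentSpace 𝓘(ℝ, E) x) : Prop :=
  IsSmoothField V ∧ ∀ x, V x ∈ vertSpace (F := F) f x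

/-- `X` is a smooth horizontal vector field. -/
def IsHorizontalField (f : M → N) (X : ∀ x : M, TangentSpace 𝓘(ℝ, E) x) : Prop :=
  IsSmoothField X ∧ ∀ x, X x ∈ horSpace (F := F) f x

/-- The horizontal distribution `(ker f_*)ᗮ` is integrable: it is closed under Lie brackets. -/
def HorizontalIntegrable (f : M → N) : Prop :=
  ∀ X Y : (∀ x : M, TangentSpace 𝓘(ℝ, E) x),
    IsHorizontalField (F := F) f X → IsHorizontalField (F := F) f Y →
      ∀ x, mlieBracket 𝓘(ℝ, E) X Y x ∈ horSpace (F := F) f x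

/-- O'Neill's tensor `A_U W = 𝓥 ∇_{𝓗 U} (𝓗 W) + 𝓗 ∇_{𝓗 U} (𝓥 W)`. -/
def oneillA (f : M → N) (U W : ∀ x : M, TangentSpace 𝓘(ℝ, E) x) (x : M) :
    TangentSpace 𝓘(ℝ, E) x :=
  vert (F := F) f x (leviCivita (fun y => hor (F := F) f y (W y)) x (hor (F := F) f x (U x)))
    + hor (F := F) f x (leviCivita (fun y => vert (F := F) f y (W y)) x (hor (F := F) f x (U x)))

variable [RiemannianBundle (fun y : N => TangentSpace 𝓘(ℝ, F) y)]

/-- `f` is a horizontally conformal submersion with dilation `lam`: it is smooth with surjective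
differentials, `lam` is positive, and `lam² g_M(X, Y) = g_N(f_* X, f_* Y)` for all horizontal
`X, Y`. -/
structure IsHorizontallyConformalSubmersion (f : M → N) (lam : M → ℝ) : Prop where
  smooth : ContMDiff 𝓘(ℝ, E) 𝓘(ℝ, F) ∞ f
  surjective : ∀ x, Function.Surjective (mfderiv 𝓘(ℝ, E) 𝓘(ℝ, F) f x)
  pos : ∀ x, 0 < lam x
  conformal : ∀ x, ∀ v ∈ horSpace (F := F) f x, ∀ w ∈ horSpace (F := F) f x,
    lam x ^ 2 * ⟪v, w⟫_ℝ
      = ⟪mfderiv 𝓘(ℝ, E) 𝓘(ℝ, F) f x v, mfderiv 𝓘(ℝ, E) 𝓘(ℝ, F) f x w⟫_ℝ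

/-- `f` is a conformal anti-invariant `ξ^⊥`-submersion with dilation `lam`: a horizontally conformal
submersion such that `ξ` is normal to `ker f_*` and `φ (ker f_*) ⊆ (ker f_*)ᗮ`. -/
structure IsConformalAntiInvariantXiPerpSubmersion
    (φ : ∀ x : M, TangentSpace 𝓘(ℝ, E) x →L[ℝ] TangentSpace 𝓘(ℝ, E) x)
    (ξ : ∀ x : M, TangentSpace 𝓘(ℝ, E) x) (f : M → N) (lam : M → ℝ) : Prop extends
    IsHorizontallyConformalSubmersion (E := E) (F := F) f lam where
  xi_horizontal : ∀ x, ξ x ∈ horSpace (F := F) f x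
  antiInvariant : ∀ x, ∀ v ∈ vertSpace (F := F) f x, φ x v ∈ horSpace (F := F) f x

end Submersion

/-! ### The pullback connection -/

section Pullback

variable {E : Type*} [NormedAddCommGroup E] [NormedSpace ℝ E]
  {M : Type*} [TopologicalSpace M] [ChartedSpace E M]
  {F : Type*} [NormedAddCommGroup F] [NormedSpace ℝ F] [FiniteDimensional ℝ F]
  {N : Type*} [TopologicalSpace N] [ChartedSpace F N] [IsManifold 𝓘(ℝ, F) ∞ N]
  [RiemannianBundle (fun y : N => TangentSpace 𝓘(ℝ, F) y)]

/-- The pullback connection `∇^f_v σ` of the Levi-Civita connection of `N`, for a section `σ` of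
`f⁻¹ TN` (a vector field along `f`) and `v` tangent to `M` at `x`. If `(s a)` is a local frame
of `TN` around `f x` and `σ = ∑ a, σ^a • (s a ∘ f)` near `x`, then
`∇^f_v σ = ∑ a, (v(σ^a) • s a (f x) + σ^a x • ∇^N_{f_* v} (s a))`. -/
def pullbackNabla (f : M → N) (σ : ∀ x : M, TangentSpace 𝓘(ℝ, F) (f x)) (x : M)
    (v : TangentSpace 𝓘(ℝ, E) x) : TangentSpace 𝓘(ℝ, F) (f x) :=
  let e := trivializationAt F (TangentSpace 𝓘(ℝ, F) : N → Type _) (f x)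
  let b := Module.finBasis ℝ F
  ∑ a, (dirDeriv (fun y => e.localFrameCoeff 𝓘(ℝ, F) b a (f y) (σ y)) x v • e.localFrame b a (f x)
    + e.localFrameCoeff 𝓘(ℝ, F) b a (f x) (σ x) •
        leviCivita (e.localFrame b a) (f x) (mfderiv 𝓘(ℝ, E) 𝓘(ℝ, F) f x v))

/-- The vector field `f_* X` along `f`. -/
def pushField (f : M → N) (X : ∀ x : M, TangentSpace 𝓘(ℝ, E) x) (x : M) :
    TangentSpace 𝓘(ℝ, F) (f x) :=
  mfderiv 𝓘(ℝ, E) 𝓘(ℝ, F) f x (X x)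

end Pullback

end

/-! Everything rests on one pointwise identity, `inner_mlieBracket_eq`: for horizontal X, Y and
vertical V, the number g_M([X,Y], V) equals the right side of (b) minus its left side. Integrability
says that these numbers all vanish, so (a) gives (b) at once. Conversely, (b) is applied to V =
𝓥[X,Y], which yields |𝓥[X,Y]|² = 0.

To get the identity, note that η(V) = 0 because ξ is horizontal, so g_M([X,Y], V) = g_M(φ[X,Y], φV),
and [X,Y] = ∇_X Y - ∇_Y X. The Sasakian formula for ∇φ trades φ∇_X Y for ∇_X(φY) plus terms in ξ and
η. Split φY = 𝓑Y + 𝓒Y. The vertical part contributes A_X 𝓑Y, since φV is horizontal. For the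
horizontal part, `inner_pullbackNabla` compares ∇_X 𝓒Y with ∇^π_X π_*𝓒Y; the difference consists of
derivatives of ln λ. One of these terms carries the factor g_M(𝓒Y, φV) = 0. Antisymmetrizing in X
and Y removes g_M(X,Y)ξ, and skewness of φ turns the gradient terms into the factor 2.

The conformal comparison is a Koszul argument: ∇^π is compatible with g_N
(`dirDeriv_inner_eq_pullbackNabla`) and torsion-free on pushed-forward fields
(`pullbackNabla_pushField_sub`), while g_N(π_*X, π_*Z) = λ² g_M(X, Z) as soon as Z is horizontal.
Both properties of ∇^π are checked in a coordinate frame.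

Regularity also has to be derived. Since ξ is a horizontal unit field, λ² = |π_*ξ|² is smooth. Then
𝓗 preserves smooth fields because g_M(W, 𝓗X) = λ⁻² g_N(π_*W, π_*X), and
`contMDiffAt_section_of_inner` recovers a smooth field from its smooth inner products. -/

/-! ### Calculus of directional derivatives. -/

section DirectionalDerivative

variable {E : Type*} [NormedAddCommGroup E] [NormedSpace ℝ E]
  {M : Type*} [TopologicalSpace M] [ChartedSpace E M]
  {u w : M → ℝ} {x : M}

theorem dirDeriv_congr (h : u =ᶠ[nhds x] w) (v : TangentSpace 𝓘(ℝ, E) x) :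
    dirDeriv u x v = dirDeriv w x v := by
  simp only [dirDeriv, mvfderiv, h.mfderiv_eq]
  rfl

theorem dirDeriv_of_eventuallyEq_const {c : ℝ} (h : u =ᶠ[nhds x] fun _ => c)
    (v : TangentSpace 𝓘(ℝ, E) x) : dirDeriv u x v = 0 := by
  rw [dirDeriv_congr h, dirDeriv, mvfderiv_const]
  rfl

theorem dirDeriv_fun_add (hu : MDifferentiableAt 𝓘(ℝ, E) 𝓘(ℝ, ℝ) u x)
    (hw : MDifferentiableAt 𝓘(ℝ, E) 𝓘(ℝ, ℝ) w x) (v : TangentSpace 𝓘(ℝ, E) x) :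
    dirDeriv (fun y => u y + w y) x v = dirDeriv u x v + dirDeriv w x v := by
  simp only [dirDeriv, mvfderiv_fun_add hu hw]
  rfl

theorem dirDeriv_fun_mul (hu : MDifferentiableAt 𝓘(ℝ, E) 𝓘(ℝ, ℝ) u x)
    (hw : MDifferentiableAt 𝓘(ℝ, E) 𝓘(ℝ, ℝ) w x) (v : TangentSpace 𝓘(ℝ, E) x) :
    dirDeriv (fun y => u y * w y) x v = u x * dirDeriv w x v + w x * dirDeriv u x v := by
  simp only [dirDeriv, mvfderiv_fun_mul hu hw]
  rfl

theorem dirDeriv_fun_mul_mul {r : M → ℝ} (hu : MDifferentiableAt 𝓘(ℝ, E) 𝓘(ℝ, ℝ) u x)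
    (hw : MDifferentiableAt 𝓘(ℝ, E) 𝓘(ℝ, ℝ) w x) (hr : MDifferentiableAt 𝓘(ℝ, E) 𝓘(ℝ, ℝ) r x)
    (v : TangentSpace 𝓘(ℝ, E) x) :
    MDifferentiableAt 𝓘(ℝ, E) 𝓘(ℝ, ℝ) (fun y => u y * w y * r y) x ∧
    dirDeriv (fun y => u y * w y * r y) x v = u x * w x * dirDeriv r x v +
      r x * (u x * dirDeriv w x v + w x * dirDeriv u x v) := by
  have huw : MDifferentiableAt 𝓘(ℝ, E) 𝓘(ℝ, ℝ) (fun y => u y * w y) x := hu.mul hw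
  exact ⟨huw.mul hr, by rw [dirDeriv_fun_mul huw hr, dirDeriv_fun_mul hu hw]⟩

theorem dirDeriv_fun_sum {ι : Type*} (s : Finset ι) {u : ι → M → ℝ}
    (hu : ∀ i, MDifferentiableAt 𝓘(ℝ, E) 𝓘(ℝ, ℝ) (u i) x) (v : TangentSpace 𝓘(ℝ, E) x) :
    dirDeriv (fun y => ∑ i ∈ s, u i y) x v = ∑ i ∈ s, dirDeriv (u i) x v := by
  classical
  suffices h : MDifferentiableAt 𝓘(ℝ, E) 𝓘(ℝ, ℝ) (fun y => ∑ i ∈ s, u i y) x ∧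
      dirDeriv (fun y => ∑ i ∈ s, u i y) x v = ∑ i ∈ s, dirDeriv (u i) x v from h.2
  induction s using Finset.induction_on with
  | empty =>
    simp only [Finset.sum_empty]
    exact ⟨mdifferentiableAt_const, dirDeriv_of_eventuallyEq_const .rfl v⟩
  | insert a s ha ih =>
    simp only [Finset.sum_insert ha]
    exact ⟨(hu a).add ih.1, by rw [dirDeriv_fun_add (hu a) ih.1, ih.2]⟩

theorem dirDeriv_add_right (v w : TangentSpace 𝓘(ℝ, E) x) :
    dirDeriv u x (v + w) = dirDeriv u x v + dirDeriv u x w :=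
  map_add _ v w

theorem dirDeriv_smul_right (c : ℝ) (v : TangentSpace 𝓘(ℝ, E) x) :
    dirDeriv u x (c • v) = c * dirDeriv u x v :=
  map_smul _ c v

/-- Converts derivatives of the dilation into derivatives of its logarithm. -/
theorem dirDeriv_log (hu : MDifferentiableAt 𝓘(ℝ, E) 𝓘(ℝ, ℝ) u x) (h0 : u x ≠ 0)
    (v : TangentSpace 𝓘(ℝ, E) x) :
    dirDeriv u x v = u x * dirDeriv (fun y => Real.log (u y)) x v := by
  have hl : DifferentiableAt ℝ Real.log (u x) := Real.differentiableAt_log h0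
  have h1 : dirDeriv (fun y => Real.log (u y)) x v = fderiv ℝ Real.log (u x) (dirDeriv u x v) := by
    have h := mvfderiv_comp_apply (I' := 𝓘(ℝ, E)) (I := 𝓘(ℝ, ℝ)) (g := Real.log) (f := u) x
      hl.mdifferentiableAt hu v
    have h' : mvfderiv 𝓘(ℝ, ℝ) Real.log (u x) = fderiv ℝ Real.log (u x) := by
      rw [mvfderiv, mfderiv_eq_fderiv]
      rfl
    rw [h'] at h
    exact h
  have h2 : dirDeriv (fun y => Real.log (u y)) x v = (u x)⁻¹ * dirDeriv u x v := by
    rw [h1, (Real.hasDerivAt_log h0).hasFDerivAt.fderiv]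
    simp [mul_comm]
  rw [h2, mul_inv_cancel_left₀ h0]

end DirectionalDerivative

/-! ### Smoothness of differentials applied to fields. -/

section SmoothDerivative

variable {E : Type*} [NormedAddCommGroup E] [NormedSpace ℝ E]
  {M : Type*} [TopologicalSpace M] [ChartedSpace E M] [IsManifold 𝓘(ℝ, E) ∞ M]
  {X : ∀ x : M, TangentSpace 𝓘(ℝ, E) x} {u : M → ℝ} {x : M}

theorem ContMDiffAt.mfderiv_apply_section {F : Type*} [NormedAddCommGroup F] [NormedSpace ℝ F]
    {N : Type*} [TopologicalSpace N] [ChartedSpace F N] [IsManifold 𝓘(ℝ, F) ∞ N] {f : M → N}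
    (hf : CMDiffAt ∞ f x) (hX : CMDiffAt ∞ (T% X) x) :
    ContMDiffAt 𝓘(ℝ, E) (𝓘(ℝ, F).prod 𝓘(ℝ, F)) ∞
      (fun y => (⟨f y, mfderiv 𝓘(ℝ, E) 𝓘(ℝ, F) f y (X y)⟩ : TangentBundle 𝓘(ℝ, F) N)) x :=
  ContMDiffAt.clm_apply_of_inCoordinates (hf.mfderiv_const (by simp)) hX hf

theorem ContMDiffAt.dirDeriv (hu : CMDiffAt ∞ u x) (hX : CMDiffAt ∞ (T% X) x) :
    CMDiffAt ∞ (fun y => dirDeriv u y (X y)) x := by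
  have h := ContMDiffAt.mfderiv_apply_section (F := ℝ) hu hX
  rw [contMDiffAt_totalSpace] at h
  have h2 := h.2
  simp only [trivializationAt_model_space_apply] at h2
  exact h2

end SmoothDerivative

/-! ### The Lie bracket as a commutator of derivations. -/

section LieBracket

variable {E : Type*} [NormedAddCommGroup E] [NormedSpace ℝ E] [CompleteSpace E]
  {M : Type*} [TopologicalSpace M] [ChartedSpace E M] [IsManifold 𝓘(ℝ, E) ∞ M]
  {X Y : ∀ x : M, TangentSpace 𝓘(ℝ, E) x} {u : M → ℝ} {x : M}

theorem ContMDiffAt.mlieBracket_infty (hX : CMDiffAt ∞ (T% X) x) (hY : CMDiffAt ∞ (T% Y) x) :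
    CMDiffAt ∞ (T% (mlieBracket 𝓘(ℝ, E) X Y)) x := by
  have : IsManifold 𝓘(ℝ, E) (minSmoothness ℝ 2) M := by
    simp only [minSmoothness_of_isRCLikeNormedField]; infer_instance
  have : IsManifold 𝓘(ℝ, E) (((⊤ : ℕ∞) : WithTop ℕ∞) + 1) M := by
    simpa using (inferInstance : IsManifold 𝓘(ℝ, E) ∞ M)
  exact ContMDiffAt.mlieBracket_vectorField (m := ⊤) (n := ⊤) hX hY (by simp)

/-- Follows from the Jacobi identity alone: apply it to uW and to W, where W x ≠ 0, and compare the
coefficients of W x. -/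
theorem dirDeriv_mlieBracket (hu : CMDiffAt ∞ u x) (hX : CMDiffAt ∞ (T% X) x)
    (hY : CMDiffAt ∞ (T% Y) x) :
    dirDeriv u x (mlieBracket 𝓘(ℝ, E) X Y x) =
      dirDeriv (fun y => dirDeriv u y (Y y)) x (X x)
        - dirDeriv (fun y => dirDeriv u y (X y)) x (Y x) := by
  rcases subsingleton_or_nontrivial (TangentSpace 𝓘(ℝ, E) x) with hs | hs
  · simp only [dirDeriv, Subsingleton.eq_zero (mlieBracket 𝓘(ℝ, E) X Y x),
      Subsingleton.eq_zero (X x), Subsingleton.eq_zero (Y x), map_zero, sub_zero]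
  obtain ⟨w, hw⟩ := exists_ne (0 : TangentSpace 𝓘(ℝ, E) x)
  have : IsManifold 𝓘(ℝ, E) (minSmoothness ℝ 3) M := by
    simp only [minSmoothness_of_isRCLikeNormedField]; infer_instance
  have h2 : minSmoothness ℝ 2 ≤ ∞ := by
    simp only [minSmoothness_of_isRCLikeNormedField]; exact ENat.LEInfty.out
  have h1 : (1 : WithTop ℕ∞) ≤ ∞ := ENat.LEInfty.out
  have h0 : (∞ : WithTop ℕ∞) ≠ 0 := by simp
  let W : ∀ y : M, TangentSpace 𝓘(ℝ, E) y := FiberBundle.extend E w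
  have hWx : W x = w := by simp [W]
  have hW : CMDiffAt ∞ (T% W) x := FiberBundle.contMDiffAt_extend 𝓘(ℝ, E) E w
  -- Leibniz twice: the terms of first order in u are symmetric under exchange of A and B, so they
  -- cancel in the Jacobi identity.
  have expand : ∀ {A B : ∀ y : M, TangentSpace 𝓘(ℝ, E) y}, CMDiffAt ∞ (T% A) x →
      CMDiffAt ∞ (T% B) x →
      mlieBracket 𝓘(ℝ, E) A (mlieBracket 𝓘(ℝ, E) B (u • W)) x =
        dirDeriv (fun y => dirDeriv u y (B y)) x (A x) • w
          + dirDeriv u x (B x) • mlieBracket 𝓘(ℝ, E) A W x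
          + (dirDeriv u x (A x) • mlieBracket 𝓘(ℝ, E) B W x
          + u x • mlieBracket 𝓘(ℝ, E) A (mlieBracket 𝓘(ℝ, E) B W) x) := by
    intro A B hA hB
    have hev : mlieBracket 𝓘(ℝ, E) B (u • W) =ᶠ[nhds x]
        ((fun y => dirDeriv u y (B y)) • W + u • mlieBracket 𝓘(ℝ, E) B W) := by
      filter_upwards [(contMDiffAt_iff_contMDiffAt_nhds (by simp)).1 (hu.of_le h1),
        (contMDiffAt_iff_contMDiffAt_nhds (by simp)).1 (hW.of_le h1)]
        with y hy1 hy2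
      exact mlieBracket_smul_right (hy1.mdifferentiableAt one_ne_zero)
        (hy2.mdifferentiableAt one_ne_zero)
    have hBu := (hu.dirDeriv hB).mdifferentiableAt h0
    have hW' := hW.mdifferentiableAt h0
    have hBW := (hB.mlieBracket_infty hW).mdifferentiableAt h0
    have hu' := hu.mdifferentiableAt h0
    rw [Filter.EventuallyEq.mlieBracket_vectorField_eq (Filter.EventuallyEq.refl _ A) hev,
      mlieBracket_add_right (hBu.smul_section hW') (hu'.smul_section hBW),
      mlieBracket_smul_right hBu hW', mlieBracket_smul_right hu' hBW, hWx]
    rfl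
  have huW : CMDiffAt ∞ (T% (u • W)) x := hu.smul_section hW
  have J1 := leibniz_identity_mlieBracket_apply (hX.of_le h2) (hY.of_le h2) (huW.of_le h2)
  have J2 := leibniz_identity_mlieBracket_apply (hX.of_le h2) (hY.of_le h2) (hW.of_le h2)
  have hXY : mlieBracket 𝓘(ℝ, E) (mlieBracket 𝓘(ℝ, E) X Y) (u • W) x =
      dirDeriv u x (mlieBracket 𝓘(ℝ, E) X Y x) • w
        + u x • mlieBracket 𝓘(ℝ, E) (mlieBracket 𝓘(ℝ, E) X Y) W x := by
    rw [mlieBracket_smul_right (hu.mdifferentiableAt h0) (hW.mdifferentiableAt h0), hWx]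
    rfl
  rw [expand hX hY, expand hY hX, hXY, J2] at J1
  refine smul_left_injective ℝ hw ?_
  simp only [sub_smul]
  rw [smul_add] at J1
  rw [← sub_eq_zero] at J1 ⊢
  rw [← neg_eq_zero, ← J1]
  abel

end LieBracket

/-! ### The Levi-Civita connection: Koszul formula, compatibility, torsion. -/

section LeviCivita

variable {E : Type*} [NormedAddCommGroup E] [NormedSpace ℝ E]
  {M : Type*} [TopologicalSpace M] [ChartedSpace E M]
  [RiemannianBundle (fun x : M => TangentSpace 𝓘(ℝ, E) x)]

theorem koszul_add_koszul (X Y Z : ∀ x : M, TangentSpace 𝓘(ℝ, E) x) (x : M) :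
    koszul X Y Z x + koszul X Z Y x = dirDeriv (fun y => ⟪Y y, Z y⟫_ℝ) x (X x) := by
  simp only [koszul, mlieBracket_swap_apply (V := Z) (W := Y), inner_neg_left,
    real_inner_comm (Y _) (Z _)]
  ring

theorem koszul_sub_koszul (X Y Z : ∀ x : M, TangentSpace 𝓘(ℝ, E) x) (x : M) :
    koszul X Y Z x - koszul Y X Z x = ⟪mlieBracket 𝓘(ℝ, E) X Y x, Z x⟫_ℝ := by
  simp only [koszul, mlieBracket_swap_apply (V := Y) (W := X), inner_neg_left,
    real_inner_comm (X _) (Y _)]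
  ring

variable [IsManifold 𝓘(ℝ, E) ∞ M] {X Y Z W : ∀ x : M, TangentSpace 𝓘(ℝ, E) x} {x : M}

theorem eq_of_inner_section {v w : TangentSpace 𝓘(ℝ, E) x}
    (h : ∀ Z : ∀ x : M, TangentSpace 𝓘(ℝ, E) x, MDiffAt (T% Z) x → ⟪v, Z x⟫_ℝ = ⟪w, Z x⟫_ℝ) :
    v = w := by
  refine ext_inner_right ℝ fun z => ?_
  simpa using h (FiberBundle.extend E z) (FiberBundle.mdifferentiableAt_extend 𝓘(ℝ, E) E z)

variable [IsContMDiffRiemannianBundle 𝓘(ℝ, E) ∞ E (fun x : M => TangentSpace 𝓘(ℝ, E) x)]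

theorem mdifferentiableAt_inner (hX : MDiffAt (T% X) x) (hY : MDiffAt (T% Y) x) :
    MDifferentiableAt 𝓘(ℝ, E) 𝓘(ℝ, ℝ) (fun y => ⟪X y, Y y⟫_ℝ) x :=
  MDifferentiableAt.inner_bundle hX hY

variable [FiniteDimensional ℝ E]

theorem tensorialAt_koszul_left (hY : MDiffAt (T% Y) x) (hZ : MDiffAt (T% Z) x) :
    TensorialAt 𝓘(ℝ, E) E (fun X => koszul X Y Z x) x where
  smul {f X} hf hX := by
    have h1 := dirDeriv_fun_mul hf (mdifferentiableAt_inner hX hZ)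
    have h2 := dirDeriv_fun_mul hf (mdifferentiableAt_inner hX hY)
    simp only [koszul, mlieBracket_smul_left hf hX, inner_add_left, Pi.smul_apply', inner_smul_left,
      inner_smul_right, inner_neg_left, conj_trivial, h1, h2, dirDeriv_smul_right, smul_eq_mul,
      neg_smul]
    simp only [dirDeriv]
    ring
  add {X X'} hX hX' := by
    have h1 := dirDeriv_fun_add (mdifferentiableAt_inner hX hZ) (mdifferentiableAt_inner hX' hZ)
    have h2 := dirDeriv_fun_add (mdifferentiableAt_inner hX hY) (mdifferentiableAt_inner hX' hY)
    simp only [koszul, mlieBracket_add_left hX hX', inner_add_left, Pi.add_apply, inner_add_right,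
      h1, h2, dirDeriv_add_right]
    ring

theorem tensorialAt_koszul_right (hX : MDiffAt (T% X) x) (hY : MDiffAt (T% Y) x) :
    TensorialAt 𝓘(ℝ, E) E (fun Z => koszul X Y Z x) x where
  smul {f Z} hf hZ := by
    have h1 := dirDeriv_fun_mul hf (mdifferentiableAt_inner hX hZ)
    have h2 := dirDeriv_fun_mul hf (mdifferentiableAt_inner hY hZ)
    simp only [koszul, mlieBracket_smul_right hf hZ, inner_add_left, Pi.smul_apply',
      inner_smul_left, inner_smul_right, h1, h2, dirDeriv_smul_right, smul_eq_mul]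
    simp only [dirDeriv, conj_trivial, real_inner_comm (Z x)]
    ring
  add {Z Z'} hZ hZ' := by
    have h1 := dirDeriv_fun_add (mdifferentiableAt_inner hX hZ) (mdifferentiableAt_inner hX hZ')
    have h2 := dirDeriv_fun_add (mdifferentiableAt_inner hY hZ) (mdifferentiableAt_inner hY hZ')
    simp only [koszul, mlieBracket_add_right hZ hZ', inner_add_left, Pi.add_apply, inner_add_right,
      h1, h2, dirDeriv_add_right]
    ring

theorem koszul_fun_add (hX : MDiffAt (T% X) x) (hY : MDiffAt (T% Y) x) (hZ : MDiffAt (T% Z) x)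
    (hW : MDiffAt (T% W) x) :
    koszul X (fun y => Y y + W y) Z x = koszul X Y Z x + koszul X W Z x := by
  have h1 := dirDeriv_fun_add (mdifferentiableAt_inner hX hY) (mdifferentiableAt_inner hX hW)
  have h2 := dirDeriv_fun_add (mdifferentiableAt_inner hY hZ) (mdifferentiableAt_inner hW hZ)
  have h3 : (fun y => Y y + W y) = Y + W := rfl
  simp only [koszul, inner_add_left, inner_add_right, h1, h2, dirDeriv_add_right]
  rw [h3, mlieBracket_add_right hY hW, mlieBracket_add_left hY hW]
  simp only [inner_add_left]
  ring

/-- The definition uses special extensions of tangent vectors; tensoriality of the Koszul expression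
in its first and third arguments makes the choice irrelevant. -/
theorem inner_leviCivita (hX : MDiffAt (T% X) x) (hY : MDiffAt (T% Y) x)
    (hZ : MDiffAt (T% Z) x) : ⟪leviCivita Y x (X x), Z x⟫_ℝ = koszul X Y Z x := by
  set b := stdOrthonormalBasis ℝ (TangentSpace 𝓘(ℝ, E) x)
  have hext : ∀ v : TangentSpace 𝓘(ℝ, E) x, MDiffAt (T% (FiberBundle.extend E v)) x :=
    fun v => FiberBundle.mdifferentiableAt_extend 𝓘(ℝ, E) E v
  have hleft : ∀ v : TangentSpace 𝓘(ℝ, E) x, koszul (FiberBundle.extend E (X x)) Y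
      (FiberBundle.extend E v) x = koszul X Y (FiberBundle.extend E v) x := fun v =>
    (tensorialAt_koszul_left hY (hext v)).pointwise (hext _) hX (by simp)
  have T := tensorialAt_koszul_right hX hY
  have hL : ∀ v, T.mkHom _ x v = koszul X Y (FiberBundle.extend E v) x :=
    fun v => T.mkHom_apply_eq_extend v
  rw [← T.mkHom_apply hZ]
  conv_rhs => rw [← b.sum_repr' (Z x)]
  simp only [leviCivita, sum_inner, map_sum, map_smul, inner_smul_left, conj_trivial, smul_eq_mul]
  refine Finset.sum_congr rfl fun i _ => ?_
  rw [hL, hleft, mul_comm]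

theorem leviCivita_sub_leviCivita (hX : MDiffAt (T% X) x) (hY : MDiffAt (T% Y) x) :
    leviCivita Y x (X x) - leviCivita X x (Y x) = mlieBracket 𝓘(ℝ, E) X Y x := by
  refine eq_of_inner_section fun Z hZ => ?_
  rw [inner_sub_left, inner_leviCivita hX hY hZ, inner_leviCivita hY hX hZ, koszul_sub_koszul]

theorem dirDeriv_inner_eq_leviCivita (hY : MDiffAt (T% Y) x) (hZ : MDiffAt (T% Z) x)
    (v : TangentSpace 𝓘(ℝ, E) x) :
    dirDeriv (fun y => ⟪Y y, Z y⟫_ℝ) x v =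
      ⟪leviCivita Y x v, Z x⟫_ℝ + ⟪Y x, leviCivita Z x v⟫_ℝ := by
  obtain ⟨X, hX, rfl⟩ : ∃ X : ∀ x : M, TangentSpace 𝓘(ℝ, E) x, MDiffAt (T% X) x ∧ X x = v :=
    ⟨_, FiberBundle.mdifferentiableAt_extend 𝓘(ℝ, E) E v, FiberBundle.extend_apply_self E v⟩
  rw [real_inner_comm _ (Y x), inner_leviCivita hX hY hZ, inner_leviCivita hX hZ hY,
    koszul_add_koszul]

theorem leviCivita_fun_add (hY : MDiffAt (T% Y) x) (hW : MDiffAt (T% W) x)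
    (v : TangentSpace 𝓘(ℝ, E) x) :
    leviCivita (fun y => Y y + W y) x v = leviCivita Y x v + leviCivita W x v := by
  obtain ⟨X, hX, rfl⟩ : ∃ X : ∀ x : M, TangentSpace 𝓘(ℝ, E) x, MDiffAt (T% X) x ∧ X x = v :=
    ⟨_, FiberBundle.mdifferentiableAt_extend 𝓘(ℝ, E) E v, FiberBundle.extend_apply_self E v⟩
  have hYW : MDiffAt (T% (fun y => Y y + W y)) x := mdifferentiableAt_add_section hY hW
  refine eq_of_inner_section fun Z hZ => ?_
  rw [inner_add_left, inner_leviCivita hX hY hZ, inner_leviCivita hX hW hZ,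
    inner_leviCivita hX hYW hZ, koszul_fun_add hX hY hZ hW]

theorem leviCivita_add_right (hY : MDiffAt (T% Y) x) (v w : TangentSpace 𝓘(ℝ, E) x) :
    leviCivita Y x (v + w) = leviCivita Y x v + leviCivita Y x w := by
  have hv := FiberBundle.mdifferentiableAt_extend 𝓘(ℝ, E) E v
  have hw := FiberBundle.mdifferentiableAt_extend 𝓘(ℝ, E) E w
  refine eq_of_inner_section fun Z hZ => ?_
  have h := (tensorialAt_koszul_left hY hZ).add hv hw
  rw [← inner_leviCivita (mdifferentiableAt_add_section hv hw) hY hZ, ← inner_leviCivita hv hY hZ,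
    ← inner_leviCivita hw hY hZ] at h
  simpa [inner_add_left] using h

theorem leviCivita_smul_right (hY : MDiffAt (T% Y) x) (c : ℝ) (v : TangentSpace 𝓘(ℝ, E) x) :
    leviCivita Y x (c • v) = c • leviCivita Y x v := by
  have hv := FiberBundle.mdifferentiableAt_extend 𝓘(ℝ, E) E v
  refine eq_of_inner_section fun Z hZ => ?_
  have hc : MDifferentiableAt 𝓘(ℝ, E) 𝓘(ℝ, ℝ) (fun _ : M => c) x := mdifferentiableAt_const
  have h := (tensorialAt_koszul_left hY hZ).smul hc hv
  rw [← inner_leviCivita (hc.smul_section hv) hY hZ, ← inner_leviCivita hv hY hZ] at h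
  simpa [inner_smul_left] using h

theorem leviCivita_sum_right {ι : Type*} (s : Finset ι) (hY : MDiffAt (T% Y) x)
    (v : ι → TangentSpace 𝓘(ℝ, E) x) :
    leviCivita Y x (∑ i ∈ s, v i) = ∑ i ∈ s, leviCivita Y x (v i) :=
  map_sum (⟨⟨leviCivita Y x, leviCivita_add_right hY⟩, leviCivita_smul_right hY⟩ :
    TangentSpace 𝓘(ℝ, E) x →ₗ[ℝ] TangentSpace 𝓘(ℝ, E) x) v s

end LeviCivita

/-! ### Smoothness of a field from its inner products. -/

section SmoothByInner

variable {E : Type*} [NormedAddCommGroup E] [NormedSpace ℝ E]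
  {M : Type*} [TopologicalSpace M] [ChartedSpace E M]

theorem ContMDiffAt.matrix_det {ι : Type*} [Fintype ι] [DecidableEq ι] {A : M → Matrix ι ι ℝ}
    {x : M} (hA : ∀ i j, CMDiffAt ∞ (fun y => A y i j) x) :
    CMDiffAt ∞ (fun y => (A y).det) x := by
  simp only [Matrix.det_apply']
  exact .sum fun σ _ => contMDiffAt_const.mul (contMDiffAt_finsetProd fun i _ => hA (σ i) i)

variable [IsManifold 𝓘(ℝ, E) ∞ M] [RiemannianBundle (fun x : M => TangentSpace 𝓘(ℝ, E) x)]
  [IsContMDiffRiemannianBundle 𝓘(ℝ, E) ∞ E (fun x : M => TangentSpace 𝓘(ℝ, E) x)]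

theorem contMDiffAt_inner {X Y : ∀ x : M, TangentSpace 𝓘(ℝ, E) x} {x : M}
    (hX : CMDiffAt ∞ (T% X) x) (hY : CMDiffAt ∞ (T% Y) x) :
    CMDiffAt ∞ (fun y => ⟪X y, Y y⟫_ℝ) x :=
  ContMDiffAt.inner_bundle hX hY

variable [FiniteDimensional ℝ E]

/-- In a local frame the coefficients of Z solve a linear system whose matrix is the invertible Gram
matrix and whose right side is smooth by hypothesis; Cramer's rule then exhibits them as smooth
quotients. -/
theorem contMDiffAt_section_of_inner {Z : ∀ x : M, TangentSpace 𝓘(ℝ, E) x} {x : M}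
    (h : ∀ W : ∀ x : M, TangentSpace 𝓘(ℝ, E) x, CMDiffAt ∞ (T% W) x →
      CMDiffAt ∞ (fun y => ⟪W y, Z y⟫_ℝ) x) :
    CMDiffAt ∞ (T% Z) x := by
  classical
  let e := trivializationAt E (TangentSpace 𝓘(ℝ, E) : M → Type _) x
  let b := Module.finBasis ℝ E
  have hx : x ∈ e.baseSet := FiberBundle.mem_baseSet_trivializationAt' x
  let s := e.localFrame b
  have hs : ∀ i, CMDiffAt ∞ (T% (s i)) x := fun i => contMDiffAt_localFrame_of_mem ∞ e b i hx
  let c : M → _ → ℝ := fun y i => e.localFrameCoeff 𝓘(ℝ, E) b i y (Z y)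
  let G : M → Matrix _ _ ℝ := fun y => Matrix.of fun i j => ⟪s i y, s j y⟫_ℝ
  let d : M → _ → ℝ := fun y i => ⟪s i y, Z y⟫_ℝ
  have hG : CMDiffAt ∞ (fun y => (G y).det) x :=
    .matrix_det fun i j => contMDiffAt_inner (hs i) (hs j)
  have hdet : ∀ y ∈ e.baseSet, (G y).det ≠ 0 := fun y hy =>
    (Matrix.posDef_gram_of_linearIndependent
      ((e.isLocalFrameOn_localFrame_baseSet 𝓘(ℝ, E) ∞ b).linearIndependent hy)).det_pos.ne'
  have hsolve : ∀ y ∈ e.baseSet, ∀ i, c y i = ((G y).updateCol i (d y)).det / (G y).det := by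
    intro y hy i
    have hd : d y = (G y).mulVec (c y) := by
      funext i
      have hZ : Z y = ∑ j, c y j • s j y := e.eq_sum_localFrameCoeff_smul (s := Z) hy
      simp only [d, Matrix.mulVec, dotProduct, G, Matrix.of_apply]
      conv_lhs => rw [hZ]
      simp only [inner_sum, inner_smul_right, mul_comm]
    rw [eq_div_iff (hdet y hy), ← Matrix.cramer_apply, Matrix.cramer_eq_adjugate_mulVec, hd,
      Matrix.mulVec_mulVec, Matrix.adjugate_mul]
    simp [Matrix.smul_mulVec, mul_comm]
  rw [contMDiffAt_iff_localFrameCoeff b hx]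
  intro i
  have hi : CMDiffAt ∞ (fun y => ((G y).updateCol i (d y)).det) x := by
    refine .matrix_det fun k j => ?_
    by_cases hj : j = i
    · subst hj
      simpa only [Matrix.updateCol_self] using h _ (hs k)
    · simpa only [Matrix.updateCol_ne hj, G, Matrix.of_apply] using contMDiffAt_inner (hs k) (hs j)
  refine (hi.div₀ hG (hdet x hx)).congr_of_eventuallyEq ?_
  filter_upwards [e.open_baseSet.mem_nhds hx] with y hy
  exact hsolve y hy i

end SmoothByInner

/-! ### Coordinate functions and coordinate frames. -/

noncomputable section CoordinateFrame

variable {F : Type*} [NormedAddCommGroup F] [NormedSpace ℝ F] [FiniteDimensional ℝ F]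
  {N : Type*} [TopologicalSpace N] [ChartedSpace F N]

/-- The `a`-th coordinate function of the preferred chart at `p`. -/
def coordFun (p : N) (a : Fin (Module.finrank ℝ F)) (z : N) : ℝ :=
  (Module.finBasis ℝ F).repr (extChartAt 𝓘(ℝ, F) p z) a

theorem contMDiffAt_coordFun {p : N} {a : Fin (Module.finrank ℝ F)} : CMDiffAt ∞ (coordFun (F := F) p a) p := by
  let L : F →L[ℝ] ℝ := ((Module.finBasis ℝ F).coord a).toContinuousLinearMap
  have hL : CMDiffAt ∞ L (extChartAt 𝓘(ℝ, F) p p) := L.contMDiff.contMDiffAt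
  exact hL.comp p contMDiffAt_extChartAt

variable [IsManifold 𝓘(ℝ, F) ∞ N]

/-- The local frame of the tangent bundle given by the preferred trivialization at `p`. -/
def coordFrame (p : N) (a : Fin (Module.finrank ℝ F)) (z : N) : TangentSpace 𝓘(ℝ, F) z :=
  (trivializationAt F (TangentSpace 𝓘(ℝ, F) : N → Type _) p).localFrame (Module.finBasis ℝ F) a z

/-- The coefficients with respect to `coordFrame p`. -/
def coordCoeff (p : N) (a : Fin (Module.finrank ℝ F)) (z : N) : TangentSpace 𝓘(ℝ, F) z →ₗ[ℝ] ℝ :=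
  (trivializationAt F (TangentSpace 𝓘(ℝ, F) : N → Type _) p).localFrameCoeff 𝓘(ℝ, F)
    (Module.finBasis ℝ F) a z

variable {p z : N} {a c : Fin (Module.finrank ℝ F)}

theorem contMDiffAt_coordFrame : CMDiffAt ∞ (T% (coordFrame p a)) p :=
  contMDiffAt_localFrame_of_mem ∞ _ _ a (FiberBundle.mem_baseSet_trivializationAt' p)

theorem mdifferentiableAt_coordFrame : MDiffAt (T% (coordFrame p a)) p :=
  contMDiffAt_coordFrame.mdifferentiableAt (by simp)

theorem sum_coordCoeff_smul (hz : z ∈ (chartAt F p).source) (v : TangentSpace 𝓘(ℝ, F) z) :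
    v = ∑ a, coordCoeff p a z v • coordFrame p a z := by
  have h := (trivializationAt F (TangentSpace 𝓘(ℝ, F) : N → Type _) p).eq_sum_localFrameCoeff_smul
    (I := 𝓘(ℝ, F)) (b := Module.finBasis ℝ F) (s := FiberBundle.extend F v) (x' := z)
    (by simpa using hz)
  simp only [FiberBundle.extend_apply_self] at h
  exact h

theorem coordCoeff_eq_repr (hz : z ∈ (chartAt F p).source) (v : TangentSpace 𝓘(ℝ, F) z) :
    coordCoeff p a z v = (Module.finBasis ℝ F).repr
      (trivializationAt F (TangentSpace 𝓘(ℝ, F) : N → Type _) p ⟨z, v⟩).2 a := by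
  have h := (trivializationAt F (TangentSpace 𝓘(ℝ, F) : N → Type _) p).localFrameCoeff_eq_coeff
    (I := 𝓘(ℝ, F)) (b := Module.finBasis ℝ F) (s := FiberBundle.extend F v) (x := z)
    (by simpa using hz) (i := a)
  simp only [FiberBundle.extend_apply_self] at h
  exact h

theorem coordCoeff_coordFrame (hz : z ∈ (chartAt F p).source) :
    coordCoeff p a z (coordFrame p c z) = if a = c then 1 else 0 := by
  have hz' : z ∈ (trivializationAt F (TangentSpace 𝓘(ℝ, F) : N → Type _) p).baseSet := by
    simpa using hz
  have h := (trivializationAt F (TangentSpace 𝓘(ℝ, F) : N → Type _)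
    p).localFrameCoeff_apply_of_mem_baseSet (I := 𝓘(ℝ, F)) (Module.finBasis ℝ F)
    hz' (coordFrame p c) a
  refine h.trans ?_
  rw [coordFrame, Bundle.Trivialization.localFrame_apply_of_mem_baseSet _ _ hz',
    Module.Basis.repr_self, Finsupp.single_apply]
  simp only [eq_comm]

/-- The preferred trivialization of the tangent bundle is the differential of the chart, so the dual
frame consists of the coordinate differentials. -/
theorem coordCoeff_eq_dirDeriv (hz : z ∈ (chartAt F p).source) (v : TangentSpace 𝓘(ℝ, F) z) :
    coordCoeff p a z v = dirDeriv (coordFun p a) z v := by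
  rw [coordCoeff_eq_repr hz]
  let L : F →L[ℝ] ℝ := ((Module.finBasis ℝ F).coord a).toContinuousLinearMap
  have hL : MDifferentiableAt 𝓘(ℝ, F) 𝓘(ℝ, ℝ) L (extChartAt 𝓘(ℝ, F) p z) :=
    L.differentiableAt.mdifferentiableAt
  have h := mvfderiv_comp_apply (I' := 𝓘(ℝ, F)) (I := 𝓘(ℝ, F)) (g := L)
    (f := extChartAt 𝓘(ℝ, F) p) z hL (mdifferentiableAt_extChartAt hz) v
  rw [← TangentBundle.continuousLinearMapAt_trivializationAt hz] at h
  have hz' : z ∈ (trivializationAt F (TangentSpace 𝓘(ℝ, F) : N → Type _) p).baseSet := by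
    simpa using hz
  have h' : mvfderiv 𝓘(ℝ, F) L (extChartAt 𝓘(ℝ, F) p z) = L := by
    rw [mvfderiv, mfderiv_eq_fderiv, L.fderiv]
    rfl
  rw [h'] at h
  have hm := Bundle.Trivialization.continuousLinearMapAt_apply_of_mem ℝ
    (trivializationAt F (TangentSpace 𝓘(ℝ, F) : N → Type _) p) hz' v
  exact (h.trans (congrArg L hm)).symm

/-- Each coordinate function has constant derivatives along the frame near p, so the bracket
annihilates all coordinate functions. This is what makes the Christoffel symbols symmetric. -/
theorem mlieBracket_coordFrame :
    mlieBracket 𝓘(ℝ, F) (coordFrame p a) (coordFrame p c) p = 0 := by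
  have hp : p ∈ (chartAt F p).source := mem_chart_source F p
  have hconst : ∀ d c, (fun z => dirDeriv (coordFun (F := F) p d) z (coordFrame p c z)) =ᶠ[nhds p]
      fun _ => if d = c then 1 else 0 := fun d c => by
    filter_upwards [(chartAt F p).open_source.mem_nhds hp] with z hz
    rw [← coordCoeff_eq_dirDeriv hz, coordCoeff_coordFrame hz]
  rw [sum_coordCoeff_smul hp (mlieBracket 𝓘(ℝ, F) (coordFrame p a) (coordFrame p c) p)]
  refine Finset.sum_eq_zero fun d _ => ?_
  rw [coordCoeff_eq_dirDeriv hp,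
    dirDeriv_mlieBracket contMDiffAt_coordFun contMDiffAt_coordFrame contMDiffAt_coordFrame,
    dirDeriv_of_eventuallyEq_const (hconst d c), dirDeriv_of_eventuallyEq_const (hconst d a),
    sub_zero, zero_smul]

end CoordinateFrame

/-! ### The pullback connection: metric compatibility and torsion. -/

section PullbackConnection

/-- The algebra behind metric compatibility: a', b' stand for derivatives of coefficients and s' for
covariant derivatives of the frame. -/
theorem sum_inner_leibniz {ι V : Type*} [Fintype ι] [NormedAddCommGroup V] [InnerProductSpace ℝ V]
    (a b a' b' : ι → ℝ) (s s' : ι → V) :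
    ∑ i, ∑ j, (a i * b j * (⟪s' i, s j⟫_ℝ + ⟪s i, s' j⟫_ℝ) +
        ⟪s i, s j⟫_ℝ * (a i * b' j + b j * a' i)) =
      ⟪∑ i, (a' i • s i + a i • s' i), ∑ j, b j • s j⟫_ℝ +
        ⟪∑ i, a i • s i, ∑ j, (b' j • s j + b j • s' j)⟫_ℝ := by
  simp only [sum_inner]
  simp only [inner_sum, ← Finset.sum_add_distrib]
  refine Finset.sum_congr rfl fun i _ => Finset.sum_congr rfl fun j _ => ?_
  simp only [inner_smul_left, inner_smul_right, conj_trivial, inner_add_left, inner_add_right]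
  ring

variable {E : Type*} [NormedAddCommGroup E] [NormedSpace ℝ E]
  {M : Type*} [TopologicalSpace M] [ChartedSpace E M]
  {F : Type*} [NormedAddCommGroup F] [NormedSpace ℝ F] [FiniteDimensional ℝ F]
  {N : Type*} [TopologicalSpace N] [ChartedSpace F N] [IsManifold 𝓘(ℝ, F) ∞ N]
  {f : M → N} {x : M}

theorem contMDiffAt_coordCoeff {σ : ∀ x : M, TangentSpace 𝓘(ℝ, F) (f x)}
    (hσ : ContMDiffAt 𝓘(ℝ, E) (𝓘(ℝ, F).prod 𝓘(ℝ, F)) ∞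
      (fun y => (⟨f y, σ y⟩ : TangentBundle 𝓘(ℝ, F) N)) x) (a : Fin (Module.finrank ℝ F)) :
    CMDiffAt ∞ (fun y => coordCoeff (f x) a (f y) (σ y)) x := by
  rw [contMDiffAt_totalSpace] at hσ
  let L : F →L[ℝ] ℝ := ((Module.finBasis ℝ F).coord a).toContinuousLinearMap
  have hL : ∀ w, CMDiffAt ∞ L w := fun w => L.contMDiff.contMDiffAt
  refine ((hL _).comp x hσ.2).congr_of_eventuallyEq ?_
  filter_upwards [hσ.1.continuousAt.preimage_mem_nhds
    ((chartAt F (f x)).open_source.mem_nhds (mem_chart_source F (f x)))] with y hy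
  exact coordCoeff_eq_repr hy (σ y)

variable [RiemannianBundle (fun y : N => TangentSpace 𝓘(ℝ, F) y)]

theorem pullbackNabla_eq (σ : ∀ x : M, TangentSpace 𝓘(ℝ, F) (f x)) (v : TangentSpace 𝓘(ℝ, E) x) :
    pullbackNabla f σ x v = ∑ a,
      (dirDeriv (fun y => coordCoeff (f x) a (f y) (σ y)) x v • coordFrame (f x) a (f x)
        + coordCoeff (f x) a (f x) (σ x) •
          leviCivita (coordFrame (f x) a) (f x) (mfderiv 𝓘(ℝ, E) 𝓘(ℝ, F) f x v)) :=
  rfl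

variable [IsContMDiffRiemannianBundle 𝓘(ℝ, F) ∞ F (fun y : N => TangentSpace 𝓘(ℝ, F) y)]

/-- Expand both sections in the coordinate frame at f x. The Gram coefficients, composed with f, are
differentiated by the chain rule and compatibility of the connection on N; the product rule does the
rest. -/
theorem dirDeriv_inner_eq_pullbackNabla (hf : CMDiffAt ∞ f x)
    {σ τ : ∀ x : M, TangentSpace 𝓘(ℝ, F) (f x)}
    (hσ : ContMDiffAt 𝓘(ℝ, E) (𝓘(ℝ, F).prod 𝓘(ℝ, F)) ∞
      (fun y => (⟨f y, σ y⟩ : TangentBundle 𝓘(ℝ, F) N)) x)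
    (hτ : ContMDiffAt 𝓘(ℝ, E) (𝓘(ℝ, F).prod 𝓘(ℝ, F)) ∞
      (fun y => (⟨f y, τ y⟩ : TangentBundle 𝓘(ℝ, F) N)) x) (v : TangentSpace 𝓘(ℝ, E) x) :
    dirDeriv (fun y => ⟪σ y, τ y⟫_ℝ) x v =
      ⟪pullbackNabla f σ x v, τ x⟫_ℝ + ⟪σ x, pullbackNabla f τ x v⟫_ℝ := by
  have hx := mem_chart_source F (f x)
  have h0 : (∞ : WithTop ℕ∞) ≠ 0 := by simp
  have hcσ := fun a => (contMDiffAt_coordCoeff hσ a).mdifferentiableAt h0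
  have hcτ := fun a => (contMDiffAt_coordCoeff hτ a).mdifferentiableAt h0
  have hf' := hf.mdifferentiableAt h0
  let g : ∀ a c : Fin (Module.finrank ℝ F), N → ℝ :=
    fun a c z => ⟪coordFrame (f x) a z, coordFrame (f x) c z⟫_ℝ
  have hg : ∀ a c, MDifferentiableAt 𝓘(ℝ, F) 𝓘(ℝ, ℝ) (g a c) (f x) := fun a c =>
    mdifferentiableAt_inner mdifferentiableAt_coordFrame mdifferentiableAt_coordFrame
  have hgf : ∀ a c, MDifferentiableAt 𝓘(ℝ, E) 𝓘(ℝ, ℝ) (fun y => g a c (f y)) x :=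
    fun a c => (hg a c).comp x hf'
  have hdg : ∀ a c, dirDeriv (fun y => g a c (f y)) x v =
      ⟪leviCivita (coordFrame (f x) a) (f x) (mfderiv 𝓘(ℝ, E) 𝓘(ℝ, F) f x v),
        coordFrame (f x) c (f x)⟫_ℝ +
      ⟪coordFrame (f x) a (f x),
        leviCivita (coordFrame (f x) c) (f x) (mfderiv 𝓘(ℝ, E) 𝓘(ℝ, F) f x v)⟫_ℝ := fun a c =>
    (mvfderiv_comp_apply x (hg a c) hf' v).trans
      (dirDeriv_inner_eq_leviCivita mdifferentiableAt_coordFrame mdifferentiableAt_coordFrame _)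
  have hev : (fun y => ⟪σ y, τ y⟫_ℝ) =ᶠ[nhds x] fun y => ∑ i : _ × _,
      (coordCoeff (f x) i.1 (f y) (σ y) * coordCoeff (f x) i.2 (f y) (τ y)) *
        g i.1 i.2 (f y) := by
    filter_upwards [hf.continuousAt.preimage_mem_nhds
      ((chartAt F (f x)).open_source.mem_nhds hx)] with y hy
    conv_lhs => rw [sum_coordCoeff_smul hy (σ y), sum_coordCoeff_smul hy (τ y)]
    rw [Fintype.sum_prod_type]
    simp only [sum_inner]
    simp only [inner_sum, inner_smul_left, inner_smul_right, conj_trivial, g]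
    exact Finset.sum_congr rfl fun a _ => Finset.sum_congr rfl fun c _ => by ring
  have hterm : ∀ a c, dirDeriv (fun y => (coordCoeff (f x) a (f y) (σ y) *
      coordCoeff (f x) c (f y) (τ y)) * g a c (f y)) x v =
      coordCoeff (f x) a (f x) (σ x) * coordCoeff (f x) c (f x) (τ x) *
        (⟪leviCivita (coordFrame (f x) a) (f x) (mfderiv 𝓘(ℝ, E) 𝓘(ℝ, F) f x v),
          coordFrame (f x) c (f x)⟫_ℝ +
        ⟪coordFrame (f x) a (f x),
          leviCivita (coordFrame (f x) c) (f x) (mfderiv 𝓘(ℝ, E) 𝓘(ℝ, F) f x v)⟫_ℝ) +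
      ⟪coordFrame (f x) a (f x), coordFrame (f x) c (f x)⟫_ℝ *
        (coordCoeff (f x) a (f x) (σ x) *
            dirDeriv (fun y => coordCoeff (f x) c (f y) (τ y)) x v +
          coordCoeff (f x) c (f x) (τ x) *
            dirDeriv (fun y => coordCoeff (f x) a (f y) (σ y)) x v) := fun a c => by
    rw [(dirDeriv_fun_mul_mul (hcσ a) (hcτ c) (hgf a c) v).2, hdg]
  have hT : ∀ i : Fin (Module.finrank ℝ F) × Fin (Module.finrank ℝ F),
      MDifferentiableAt 𝓘(ℝ, E) 𝓘(ℝ, ℝ) (fun y => (coordCoeff (f x) i.1 (f y) (σ y) *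
        coordCoeff (f x) i.2 (f y) (τ y)) * g i.1 i.2 (f y)) x :=
    fun i => (dirDeriv_fun_mul_mul (hcσ i.1) (hcτ i.2) (hgf i.1 i.2) v).1
  have hσx := sum_coordCoeff_smul hx (σ x)
  have hτx := sum_coordCoeff_smul hx (τ x)
  rw [dirDeriv_congr hev, dirDeriv_fun_sum _ hT, Fintype.sum_prod_type, pullbackNabla_eq,
    pullbackNabla_eq]
  simp only [hterm]
  rw [sum_inner_leibniz, ← hσx, ← hτx]

variable [IsManifold 𝓘(ℝ, E) ∞ M] [CompleteSpace E]

/-- With z^a the coordinates at f x, the components of f_*Z are Z(z^a ∘ f), so the derivative terms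
differ by [X,Y](z^a ∘ f), the components of f_*[X,Y]. The Christoffel terms cancel by symmetry. -/
theorem pullbackNabla_pushField_sub (hf : CMDiffAt ∞ f x)
    {X Y : ∀ x : M, TangentSpace 𝓘(ℝ, E) x} (hX : CMDiffAt ∞ (T% X) x)
    (hY : CMDiffAt ∞ (T% Y) x) :
    pullbackNabla (F := F) f (pushField f Y) x (X x) -
        pullbackNabla (F := F) f (pushField f X) x (Y x) =
      mfderiv 𝓘(ℝ, E) 𝓘(ℝ, F) f x (mlieBracket 𝓘(ℝ, E) X Y x) := by
  have hx := mem_chart_source F (f x)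
  have hu : ∀ a, CMDiffAt ∞ (fun y => coordFun (F := F) (f x) a (f y)) x := fun a =>
    contMDiffAt_coordFun.comp x hf
  have hf1 : ∀ᶠ y in nhds x, MDifferentiableAt 𝓘(ℝ, E) 𝓘(ℝ, F) f y :=
    ((contMDiffAt_iff_contMDiffAt_nhds (n := 1) (by simp)).1 (hf.of_le ENat.LEInfty.out)).mono
      fun y hy => hy.mdifferentiableAt one_ne_zero
  have hcoeff : ∀ a, ∀ᶠ y in nhds x, ∀ v : TangentSpace 𝓘(ℝ, E) y,
      coordCoeff (f x) a (f y) (mfderiv 𝓘(ℝ, E) 𝓘(ℝ, F) f y v) =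
        dirDeriv (fun y => coordFun (F := F) (f x) a (f y)) y v := fun a => by
    filter_upwards [hf1, hf.continuousAt.preimage_mem_nhds
      ((chartAt F (f x)).open_source.mem_nhds hx)] with y hy hys v
    rw [coordCoeff_eq_dirDeriv hys]
    refine (mvfderiv_comp_apply y ?_ hy v).symm
    let L : F →L[ℝ] ℝ := ((Module.finBasis ℝ F).coord a).toContinuousLinearMap
    have hL : MDifferentiableAt 𝓘(ℝ, F) 𝓘(ℝ, ℝ) L (extChartAt 𝓘(ℝ, F) (f x) (f y)) :=
      L.differentiableAt.mdifferentiableAt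
    exact hL.comp (f y) (mdifferentiableAt_extChartAt hys)
  have hderiv : ∀ a (Z : ∀ x : M, TangentSpace 𝓘(ℝ, E) x) (v : TangentSpace 𝓘(ℝ, E) x),
      dirDeriv (fun y => coordCoeff (f x) a (f y) (pushField (F := F) f Z y)) x v =
        dirDeriv (fun y => dirDeriv (fun y => coordFun (F := F) (f x) a (f y)) y (Z y)) x v :=
    fun a Z v => dirDeriv_congr ((hcoeff a).mono fun y hy => hy (Z y)) v
  have hsym : ∀ a c, leviCivita (coordFrame (F := F) (f x) a) (f x) (coordFrame (f x) c (f x)) =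
      leviCivita (coordFrame (f x) c) (f x) (coordFrame (f x) a (f x)) := fun a c => by
    rw [← sub_eq_zero, leviCivita_sub_leviCivita mdifferentiableAt_coordFrame
      mdifferentiableAt_coordFrame, mlieBracket_coordFrame]
  have hnabla : ∀ a (v : TangentSpace 𝓘(ℝ, F) (f x)), leviCivita (coordFrame (f x) a) (f x) v =
      ∑ c, coordCoeff (f x) c (f x) v •
        leviCivita (coordFrame (f x) a) (f x) (coordFrame (f x) c (f x)) := fun a v => by
    conv_lhs => rw [sum_coordCoeff_smul hx v]
    rw [leviCivita_sum_right _ mdifferentiableAt_coordFrame]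
    simp only [leviCivita_smul_right mdifferentiableAt_coordFrame]
  rw [sum_coordCoeff_smul hx (mfderiv 𝓘(ℝ, E) 𝓘(ℝ, F) f x _), pullbackNabla_eq, pullbackNabla_eq]
  simp only [hderiv, (hcoeff _).self_of_nhds, dirDeriv_mlieBracket (hu _) hX hY, sub_smul,
    Finset.sum_add_distrib, Finset.sum_sub_distrib]
  have hcross : ∑ a, coordCoeff (f x) a (f x) (pushField (F := F) f Y x) •
        leviCivita (coordFrame (f x) a) (f x) (mfderiv 𝓘(ℝ, E) 𝓘(ℝ, F) f x (X x)) =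
      ∑ a, coordCoeff (f x) a (f x) (pushField (F := F) f X x) •
        leviCivita (coordFrame (f x) a) (f x) (mfderiv 𝓘(ℝ, E) 𝓘(ℝ, F) f x (Y x)) := by
    simp only [hnabla _ (mfderiv 𝓘(ℝ, E) 𝓘(ℝ, F) f x _), Finset.smul_sum]
    rw [Finset.sum_comm]
    refine Finset.sum_congr rfl fun a _ => Finset.sum_congr rfl fun c _ => ?_
    rw [smul_comm, hsym]
    rfl
  rw [hcross]
  abel

end PullbackConnection

/-! ### Horizontally conformal submersions. -/

section ConformalSubmersion

theorem contMDiffAt_inner_pushField {E : Type*} [NormedAddCommGroup E] [NormedSpace ℝ E]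
    {M : Type*} [TopologicalSpace M] [ChartedSpace E M] [IsManifold 𝓘(ℝ, E) ∞ M]
    {F : Type*} [NormedAddCommGroup F] [NormedSpace ℝ F]
    {N : Type*} [TopologicalSpace N] [ChartedSpace F N] [IsManifold 𝓘(ℝ, F) ∞ N]
    [RiemannianBundle (fun y : N => TangentSpace 𝓘(ℝ, F) y)]
    [IsContMDiffRiemannianBundle 𝓘(ℝ, F) ∞ F (fun y : N => TangentSpace 𝓘(ℝ, F) y)]
    {f : M → N} {x : M}
    (hf : CMDiffAt ∞ f x) {X Y : ∀ x : M, TangentSpace 𝓘(ℝ, E) x}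
    (hX : CMDiffAt ∞ (T% X) x) (hY : CMDiffAt ∞ (T% Y) x) :
    CMDiffAt ∞ (fun y => ⟪pushField (F := F) f X y, pushField (F := F) f Y y⟫_ℝ) x :=
  ContMDiffAt.inner_bundle (hf.mfderiv_apply_section hX) (hf.mfderiv_apply_section hY)

variable {E : Type*} [NormedAddCommGroup E] [NormedSpace ℝ E]
  {M : Type*} [TopologicalSpace M] [ChartedSpace E M]
  [RiemannianBundle (fun x : M => TangentSpace 𝓘(ℝ, E) x)]
  {F : Type*} [NormedAddCommGroup F] [NormedSpace ℝ F]
  {N : Type*} [TopologicalSpace N] [ChartedSpace F N]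
  {f : M → N} {lam : M → ℝ} {x : M}

theorem inner_vert_hor {v w : TangentSpace 𝓘(ℝ, E) x} (hv : v ∈ vertSpace (F := F) f x)
    (hw : w ∈ horSpace (F := F) f x) : ⟪v, w⟫_ℝ = 0 :=
  hw v hv

theorem inner_hor_vert {v w : TangentSpace 𝓘(ℝ, E) x} (hv : v ∈ vertSpace (F := F) f x)
    (hw : w ∈ horSpace (F := F) f x) : ⟪w, v⟫_ℝ = 0 := by
  rw [real_inner_comm, inner_vert_hor hv hw]

variable [FiniteDimensional ℝ E]

theorem vert_add_hor (v : TangentSpace 𝓘(ℝ, E) x) : vert (F := F) f x v + hor (F := F) f x v = v :=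
  Submodule.starProjection_add_starProjection_orthogonal v

theorem vert_mem (v : TangentSpace 𝓘(ℝ, E) x) : vert (F := F) f x v ∈ vertSpace (F := F) f x :=
  Submodule.starProjection_apply_mem _ v

theorem hor_mem (v : TangentSpace 𝓘(ℝ, E) x) : hor (F := F) f x v ∈ horSpace (F := F) f x :=
  Submodule.starProjection_apply_mem _ v

theorem hor_of_mem {v : TangentSpace 𝓘(ℝ, E) x} (hv : v ∈ horSpace (F := F) f x) :
    hor (F := F) f x v = v :=
  Submodule.starProjection_eq_self_iff.2 hv

theorem vert_of_mem {v : TangentSpace 𝓘(ℝ, E) x} (hv : v ∈ vertSpace (F := F) f x) :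
    vert (F := F) f x v = v :=
  Submodule.starProjection_eq_self_iff.2 hv

theorem mfderiv_hor (v : TangentSpace 𝓘(ℝ, E) x) :
    mfderiv 𝓘(ℝ, E) 𝓘(ℝ, F) f x (hor (F := F) f x v) = mfderiv 𝓘(ℝ, E) 𝓘(ℝ, F) f x v := by
  have h : mfderiv 𝓘(ℝ, E) 𝓘(ℝ, F) f x (vert (F := F) f x v) = 0 := vert_mem v
  conv_rhs => rw [← vert_add_hor (F := F) (f := f) v, map_add, h, zero_add]

theorem inner_hor_right {w : TangentSpace 𝓘(ℝ, E) x} (hw : w ∈ horSpace (F := F) f x)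
    (v : TangentSpace 𝓘(ℝ, E) x) : ⟪hor (F := F) f x v, w⟫_ℝ = ⟪v, w⟫_ℝ := by
  conv_rhs => rw [← vert_add_hor (F := F) (f := f) v, inner_add_left,
    inner_vert_hor (vert_mem v) hw, zero_add]

variable [RiemannianBundle (fun y : N => TangentSpace 𝓘(ℝ, F) y)]

/-- Only one argument must be horizontal, because the differential kills the vertical part of the
other; this lets brackets and arbitrary test fields enter. -/
theorem IsHorizontallyConformalSubmersion.inner_mfderiv
    (hf : IsHorizontallyConformalSubmersion (E := E) (F := F) f lam)
    (v : TangentSpace 𝓘(ℝ, E) x) {w : TangentSpace 𝓘(ℝ, E) x} (hw : w ∈ horSpace (F := F) f x) :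
    ⟪mfderiv 𝓘(ℝ, E) 𝓘(ℝ, F) f x v, mfderiv 𝓘(ℝ, E) 𝓘(ℝ, F) f x w⟫_ℝ =
      lam x ^ 2 * ⟪v, w⟫_ℝ := by
  rw [← mfderiv_hor v, ← hf.conformal x _ (hor_mem v) w hw, inner_hor_right hw]

variable [IsManifold 𝓘(ℝ, E) ∞ M] [IsManifold 𝓘(ℝ, F) ∞ N]

variable [IsContMDiffRiemannianBundle 𝓘(ℝ, E) ∞ E (fun x : M => TangentSpace 𝓘(ℝ, E) x)]
  [IsContMDiffRiemannianBundle 𝓘(ℝ, F) ∞ F (fun y : N => TangentSpace 𝓘(ℝ, F) y)]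
  {X Y Z : ∀ x : M, TangentSpace 𝓘(ℝ, E) x}

theorem IsHorizontallyConformalSubmersion.contMDiffAt_hor
    (hf : IsHorizontallyConformalSubmersion (E := E) (F := F) f lam) (hlam : CMDiffAt ∞ lam x)
    (hX : CMDiffAt ∞ (T% X) x) : CMDiffAt ∞ (T% (fun y => hor (F := F) f y (X y))) x := by
  refine contMDiffAt_section_of_inner fun W hW => ?_
  have h := contMDiffAt_inner_pushField (F := F) hf.smooth.contMDiffAt hW hX
  have hl : CMDiffAt ∞ (fun y => lam y ^ 2) x := hlam.pow 2
  refine (h.div₀ hl (pow_ne_zero 2 (hf.pos x).ne')).congr_of_eventuallyEq (.of_forall fun y => ?_)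
  refine (eq_div_iff (pow_ne_zero 2 (hf.pos y).ne')).2 ?_
  rw [mul_comm, ← hf.inner_mfderiv _ (hor_mem (X y)), mfderiv_hor]
  rfl

theorem IsHorizontallyConformalSubmersion.contMDiffAt_vert
    (hf : IsHorizontallyConformalSubmersion (E := E) (F := F) f lam) (hlam : CMDiffAt ∞ lam x)
    (hX : CMDiffAt ∞ (T% X) x) : CMDiffAt ∞ (T% (fun y => vert (F := F) f y (X y))) x := by
  have h : ∀ y, vert (F := F) f y (X y) = X y - hor (F := F) f y (X y) :=
    fun y => eq_sub_of_add_eq (vert_add_hor (X y))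
  simp only [h]
  exact hX.sub_section (hf.contMDiffAt_hor hlam hX)

variable [FiniteDimensional ℝ F]

/-- The conformal change formula for the Levi-Civita connection, transported along f: metric
compatibility and vanishing torsion of the pullback connection determine the left side as a Koszul
expression for λ² g_M. -/
theorem IsHorizontallyConformalSubmersion.inner_pullbackNabla
    (hf : IsHorizontallyConformalSubmersion (E := E) (F := F) f lam) (hlam : CMDiffAt ∞ lam x)
    (hX : CMDiffAt ∞ (T% X) x) (hY : CMDiffAt ∞ (T% Y) x) (hZ : CMDiffAt ∞ (T% Z) x)
    (hXh : ∀ y, X y ∈ horSpace (F := F) f y) (hYh : ∀ y, Y y ∈ horSpace (F := F) f y)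
    (hZh : ∀ y, Z y ∈ horSpace (F := F) f y) :
    ⟪pullbackNabla (F := F) f (pushField f Y) x (X x), pushField (F := F) f Z x⟫_ℝ =
      lam x ^ 2 * (⟪leviCivita Y x (X x), Z x⟫_ℝ
        + dirDeriv (fun y => Real.log (lam y)) x (X x) * ⟪Y x, Z x⟫_ℝ
        + dirDeriv (fun y => Real.log (lam y)) x (Y x) * ⟪X x, Z x⟫_ℝ
        - dirDeriv (fun y => Real.log (lam y)) x (Z x) * ⟪X x, Y x⟫_ℝ) := by
  have h0 : (∞ : WithTop ℕ∞) ≠ 0 := by simp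
  have hlam' := hlam.mdifferentiableAt h0
  have hfx : CMDiffAt ∞ f x := hf.smooth.contMDiffAt
  have hmetric : ∀ {A B : ∀ x : M, TangentSpace 𝓘(ℝ, E) x}, CMDiffAt ∞ (T% A) x →
      CMDiffAt ∞ (T% B) x → (∀ y, B y ∈ horSpace (F := F) f y) →
      ∀ v : TangentSpace 𝓘(ℝ, E) x,
      ⟪pullbackNabla (F := F) f (pushField f A) x v, pushField (F := F) f B x⟫_ℝ +
        ⟪pullbackNabla (F := F) f (pushField f B) x v, pushField (F := F) f A x⟫_ℝ =
      lam x ^ 2 * (dirDeriv (fun y => ⟪A y, B y⟫_ℝ) x v +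
        2 * dirDeriv (fun y => Real.log (lam y)) x v * ⟪A x, B x⟫_ℝ) := by
    intro A B hA hB hBh v
    have h1 := dirDeriv_inner_eq_pullbackNabla (F := F) hfx (hfx.mfderiv_apply_section hA)
      (hfx.mfderiv_apply_section hB) v
    have h2 : (fun y => ⟪mfderiv 𝓘(ℝ, E) 𝓘(ℝ, F) f y (A y),
        mfderiv 𝓘(ℝ, E) 𝓘(ℝ, F) f y (B y)⟫_ℝ) = fun y => lam y * lam y * ⟪A y, B y⟫_ℝ :=
      funext fun y => by rw [hf.inner_mfderiv _ (hBh y), sq]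
    have hAB := mdifferentiableAt_inner (hA.mdifferentiableAt h0) (hB.mdifferentiableAt h0)
    rw [h2, (dirDeriv_fun_mul_mul hlam' hlam' hAB v).2, dirDeriv_log hlam' (hf.pos x).ne' v] at h1
    refine Eq.trans ?_ (h1.symm.trans ?_)
    · rw [real_inner_comm (pushField (F := F) f A x)]
      rfl
    · ring
  have htorsion : ∀ {A B C : ∀ x : M, TangentSpace 𝓘(ℝ, E) x}, CMDiffAt ∞ (T% A) x →
      CMDiffAt ∞ (T% B) x → (∀ y, C y ∈ horSpace (F := F) f y) →
      ⟪pullbackNabla (F := F) f (pushField f B) x (A x), pushField (F := F) f C x⟫_ℝ -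
        ⟪pullbackNabla (F := F) f (pushField f A) x (B x), pushField (F := F) f C x⟫_ℝ =
      lam x ^ 2 * ⟪mlieBracket 𝓘(ℝ, E) A B x, C x⟫_ℝ := by
    intro A B C hA hB hCh
    rw [← inner_sub_left, pullbackNabla_pushField_sub hfx hA hB]
    exact hf.inner_mfderiv _ (hCh x)
  rw [inner_leviCivita (hX.mdifferentiableAt h0) (hY.mdifferentiableAt h0)
    (hZ.mdifferentiableAt h0), koszul]
  have e1 := hmetric hY hZ hZh (X x)
  have e2 := hmetric hX hZ hZh (Y x)
  have e3 := hmetric hX hY hYh (Z x)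
  have t1 := htorsion (C := Z) hX hY hZh
  have t2 := htorsion (C := Y) hX hZ hYh
  have t3 := htorsion (C := X) hY hZ hXh
  -- The signs and the factor 1/2 are those of the Koszul formula: three compatibility relations and
  -- three torsion relations.
  linear_combination (1 / 2) * (e1 + e2 - e3 + t1 - t2 - t3)

end ConformalSubmersion

/-! ### Almost contact metric identities. -/

section ContactMetric

variable {E : Type*} [NormedAddCommGroup E] [NormedSpace ℝ E]
  {M : Type*} [TopologicalSpace M] [ChartedSpace E M]
  [IsManifold 𝓘(ℝ, E) ∞ M] [RiemannianBundle (fun x : M => TangentSpace 𝓘(ℝ, E) x)]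
  {φ : ∀ x : M, TangentSpace 𝓘(ℝ, E) x →L[ℝ] TangentSpace 𝓘(ℝ, E) x}
  {ξ : ∀ x : M, TangentSpace 𝓘(ℝ, E) x} {η : ∀ x : M, TangentSpace 𝓘(ℝ, E) x →L[ℝ] ℝ}

namespace IsAlmostContactMetric

theorem eta_eq_inner (h : IsAlmostContactMetric φ ξ η) (x : M) (v : TangentSpace 𝓘(ℝ, E) x) :
    η x v = ⟪v, ξ x⟫_ℝ := by
  have := h.inner_phi_phi x v (ξ x)
  rw [h.phi_xi, inner_zero_right, h.eta_xi] at this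
  linarith

/-- Apply the compatibility of φ with the metric to v and φw; the η terms drop out because η ∘ φ =
0. -/
theorem inner_phi_left (h : IsAlmostContactMetric φ ξ η) (x : M) (v w : TangentSpace 𝓘(ℝ, E) x) :
    ⟪φ x v, w⟫_ℝ = -⟪v, φ x w⟫_ℝ := by
  have := h.inner_phi_phi x v (φ x w)
  rw [h.eta_phi, h.phi_phi, inner_add_right, inner_neg_right, inner_smul_right,
    ← h.eta_eq_inner, h.eta_phi] at this
  linarith

theorem contMDiffAt_phi (h : IsAlmostContactMetric φ ξ η) {X : ∀ x : M, TangentSpace 𝓘(ℝ, E) x}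
    {x : M} (hX : CMDiffAt ∞ (T% X) x) : CMDiffAt ∞ (T% (fun y => φ y (X y))) x :=
  ContMDiffAt.clm_bundle_apply h.smooth_phi.contMDiffAt hX

end IsAlmostContactMetric

end ContactMetric

/-! ### The components 𝓑 and 𝓒, tested against φ(ker f_*) and horizontal vectors. -/

section AntiInvariantSubmersion

variable {E : Type*} [NormedAddCommGroup E] [NormedSpace ℝ E] [FiniteDimensional ℝ E]
  {M : Type*} [TopologicalSpace M] [ChartedSpace E M]
  [RiemannianBundle (fun x : M => TangentSpace 𝓘(ℝ, E) x)]
  {F : Type*} [NormedAddCommGroup F] [NormedSpace ℝ F]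
  {N : Type*} [TopologicalSpace N] [ChartedSpace F N]
  {φ : ∀ x : M, TangentSpace 𝓘(ℝ, E) x →L[ℝ] TangentSpace 𝓘(ℝ, E) x} {f : M → N}

theorem inner_compC_phi {X : ∀ x : M, TangentSpace 𝓘(ℝ, E) x} {x : M}
    {v : TangentSpace 𝓘(ℝ, E) x} (hv : v ∈ vertSpace (F := F) f x) :
    ⟪compC (F := F) φ f X x, φ x v⟫_ℝ = 0 := by
  have h : compC (F := F) φ f X x ∈ muSpace (F := F) φ f x :=
    Submodule.starProjection_apply_mem _ _
  rw [real_inner_comm]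
  exact h.2 _ ⟨v, hv, rfl⟩

theorem inner_oneillA_compB [IsManifold 𝓘(ℝ, E) ∞ M]
    {X Y : ∀ x : M, TangentSpace 𝓘(ℝ, E) x} {x : M}
    (hX : X x ∈ horSpace (F := F) f x) {w : TangentSpace 𝓘(ℝ, E) x}
    (hw : w ∈ horSpace (F := F) f x) :
    ⟪oneillA (F := F) f X (compB (F := F) φ f Y) x, w⟫_ℝ =
      ⟪leviCivita (compB (F := F) φ f Y) x (X x), w⟫_ℝ := by
  have h : ∀ y, vert (F := F) f y (compB (F := F) φ f Y y) = compB (F := F) φ f Y y :=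
    fun y => vert_of_mem (Submodule.starProjection_apply_mem _ _)
  rw [oneillA, inner_add_left, inner_vert_hor (vert_mem _) hw, inner_hor_right hw, hor_of_mem hX,
    zero_add, funext h]

end AntiInvariantSubmersion

/-! ### Anti-invariant submersions and the bracket identity. -/

section AntiInvariantSubmersion

variable {E : Type*} [NormedAddCommGroup E] [NormedSpace ℝ E]
  {M : Type*} [TopologicalSpace M] [ChartedSpace E M] [IsManifold 𝓘(ℝ, E) ∞ M]
  [RiemannianBundle (fun x : M => TangentSpace 𝓘(ℝ, E) x)]
  {F : Type*} [NormedAddCommGroup F] [NormedSpace ℝ F]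
  {N : Type*} [TopologicalSpace N] [ChartedSpace F N]
  [RiemannianBundle (fun y : N => TangentSpace 𝓘(ℝ, F) y)]
  {φ : ∀ x : M, TangentSpace 𝓘(ℝ, E) x →L[ℝ] TangentSpace 𝓘(ℝ, E) x}
  {ξ : ∀ x : M, TangentSpace 𝓘(ℝ, E) x} {η : ∀ x : M, TangentSpace 𝓘(ℝ, E) x →L[ℝ] ℝ}
  {f : M → N} {lam : M → ℝ}

namespace IsConformalAntiInvariantXiPerpSubmersion

theorem eta_eq_zero_of_mem_vertSpace
    (hf : IsConformalAntiInvariantXiPerpSubmersion (F := F) φ ξ f lam)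
    (hM : IsAlmostContactMetric φ ξ η) {x : M} {v : TangentSpace 𝓘(ℝ, E) x}
    (hv : v ∈ vertSpace (F := F) f x) : η x v = 0 := by
  rw [hM.eta_eq_inner, inner_vert_hor hv (hf.xi_horizontal x)]

variable [FiniteDimensional ℝ E]

/-- For vertical w, g(φw, φX) = g(w, X) - η(w)η(X) = 0, so the horizontal part of φX already lies in
μ. Hence 𝓑 and 𝓒 together exhaust φX, and 𝓒 inherits smoothness from 𝓗. -/
theorem compC_eq_hor (hf : IsConformalAntiInvariantXiPerpSubmersion (F := F) φ ξ f lam)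
    (hM : IsAlmostContactMetric φ ξ η) {X : ∀ x : M, TangentSpace 𝓘(ℝ, E) x} {x : M}
    (hX : X x ∈ horSpace (F := F) f x) :
    compC (F := F) φ f X x = hor (F := F) f x (φ x (X x)) := by
  have hmem : hor (F := F) f x (φ x (X x)) ∈ muSpace (F := F) φ f x := by
    refine Submodule.mem_inf.2 ⟨hor_mem _, ?_⟩
    rintro _ ⟨w, hw, rfl⟩
    change ⟪φ x w, hor (F := F) f x (φ x (X x))⟫_ℝ = 0
    rw [real_inner_comm, inner_hor_right (hf.antiInvariant x w hw), hM.inner_phi_phi,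
      hf.eta_eq_zero_of_mem_vertSpace hM hw, inner_hor_vert hw hX]
    simp
  refine Submodule.eq_starProjection_of_mem_of_inner_eq_zero hmem fun w hw => ?_
  rw [sub_eq_of_eq_add (vert_add_hor (F := F) (f := f) (φ x (X x))).symm]
  exact inner_vert_hor (vert_mem _) hw.1

theorem compC_mem (hf : IsConformalAntiInvariantXiPerpSubmersion (F := F) φ ξ f lam)
    (hM : IsAlmostContactMetric φ ξ η) {X : ∀ x : M, TangentSpace 𝓘(ℝ, E) x} {x : M}
    (hX : X x ∈ horSpace (F := F) f x) : compC (F := F) φ f X x ∈ horSpace (F := F) f x := by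
  rw [hf.compC_eq_hor hM hX]
  exact hor_mem _

theorem inner_compC (hf : IsConformalAntiInvariantXiPerpSubmersion (F := F) φ ξ f lam)
    (hM : IsAlmostContactMetric φ ξ η) {X : ∀ x : M, TangentSpace 𝓘(ℝ, E) x} {x : M}
    (hX : X x ∈ horSpace (F := F) f x) {w : TangentSpace 𝓘(ℝ, E) x}
    (hw : w ∈ horSpace (F := F) f x) : ⟪compC (F := F) φ f X x, w⟫_ℝ = ⟪φ x (X x), w⟫_ℝ := by
  rw [hf.compC_eq_hor hM hX, inner_hor_right hw]

variable [IsManifold 𝓘(ℝ, F) ∞ N]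
  [IsContMDiffRiemannianBundle 𝓘(ℝ, F) ∞ F (fun y : N => TangentSpace 𝓘(ℝ, F) y)]

/-- The field ξ is horizontal of unit length, so λ is the square root of the positive smooth
function |f_*ξ|². -/
theorem contMDiff_dilation (hf : IsConformalAntiInvariantXiPerpSubmersion (F := F) φ ξ f lam)
    (hM : IsAlmostContactMetric φ ξ η) : CMDiff ∞ lam := by
  intro x
  have h := contMDiffAt_inner_pushField (F := F) hf.smooth.contMDiffAt (x := x)
    (hM.smooth_xi x) (hM.smooth_xi x)
  have hsq : ∀ y, ⟪pushField (F := F) f ξ y, pushField (F := F) f ξ y⟫_ℝ = lam y ^ 2 := fun y => by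
    refine (hf.inner_mfderiv _ (hf.xi_horizontal y)).trans ?_
    rw [← hM.eta_eq_inner, hM.eta_xi, mul_one]
  simp only [hsq] at h
  have hs : ContMDiffAt 𝓘(ℝ, ℝ) 𝓘(ℝ, ℝ) ∞ Real.sqrt (lam x ^ 2) :=
    (Real.contDiffAt_sqrt (pow_ne_zero 2 (hf.pos x).ne')).contMDiffAt
  refine (hs.comp x h).congr_of_eventuallyEq (.of_forall fun y => ?_)
  exact (Real.sqrt_sq (hf.pos y).le).symm

variable [IsContMDiffRiemannianBundle 𝓘(ℝ, E) ∞ E (fun x : M => TangentSpace 𝓘(ℝ, E) x)]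
  [FiniteDimensional ℝ F]

theorem inner_mlieBracket_eq
    (hf : IsConformalAntiInvariantXiPerpSubmersion (F := F) φ ξ f lam) (hM : IsSasakian φ ξ η)
    {X Y V : ∀ x : M, TangentSpace 𝓘(ℝ, E) x} (hX : IsHorizontalField (F := F) f X)
    (hY : IsHorizontalField (F := F) f Y) (hV : IsVerticalField (F := F) f V) (x : M) :
    ⟪mlieBracket 𝓘(ℝ, E) X Y x, V x⟫_ℝ =
      ⟪oneillA (F := F) f X (compB (F := F) φ f Y) x
          - oneillA (F := F) f Y (compB (F := F) φ f X) x
          - dirDeriv (fun y => Real.log (lam y)) x (compC (F := F) φ f Y x) • X x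
          + dirDeriv (fun y => Real.log (lam y)) x (compC (F := F) φ f X x) • Y x
          - (2 * ⟪compC (F := F) φ f X x, Y x⟫_ℝ) • riemGrad (fun y => Real.log (lam y)) x
          - η x (Y x) • X x + η x (X x) • Y x,
        φ x (V x)⟫_ℝ
      - (1 / lam x ^ 2) *
        ⟪pullbackNabla (F := F) f (pushField f (compC (F := F) φ f X)) x (Y x)
            - pullbackNabla (F := F) f (pushField f (compC (F := F) φ f Y)) x (X x),
          pushField (F := F) f (fun y => φ y (V y)) x⟫_ℝ := by
  have h0 : (∞ : WithTop ℕ∞) ≠ 0 := by simp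
  have hlam := hf.contMDiff_dilation hM.toIsAlmostContactMetric x
  have hφV : ∀ y, φ y (V y) ∈ horSpace (F := F) f y := fun y => hf.antiInvariant y _ (hV.2 y)
  have hφVs := hM.contMDiffAt_phi (hV.1 x)
  have hgrad : ⟪riemGrad (fun y => Real.log (lam y)) x, φ x (V x)⟫_ℝ =
      dirDeriv (fun y => Real.log (lam y)) x (φ x (V x)) :=
    InnerProductSpace.toDual_symm_apply
  -- One half of the identity, before antisymmetrizing: it is used for (X, Y) and for (Y, X).
  have key : ∀ {A B : ∀ x : M, TangentSpace 𝓘(ℝ, E) x}, IsHorizontalField (F := F) f A →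
      IsHorizontalField (F := F) f B →
      ⟪φ x (leviCivita B x (A x)), φ x (V x)⟫_ℝ =
        ⟪oneillA (F := F) f A (compB (F := F) φ f B) x, φ x (V x)⟫_ℝ
        + (1 / lam x ^ 2) *
          ⟪pullbackNabla (F := F) f (pushField f (compC (F := F) φ f B)) x (A x),
            pushField (F := F) f (fun y => φ y (V y)) x⟫_ℝ
        - dirDeriv (fun y => Real.log (lam y)) x (compC (F := F) φ f B x) * ⟪A x, φ x (V x)⟫_ℝ
        + dirDeriv (fun y => Real.log (lam y)) x (φ x (V x)) * ⟪A x, φ x (B x)⟫_ℝ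
        + ⟪A x, B x⟫_ℝ * ⟪ξ x, φ x (V x)⟫_ℝ - η x (B x) * ⟪A x, φ x (V x)⟫_ℝ := by
    intro A B hA hB
    have hφB := hM.contMDiffAt_phi (hB.1 x)
    have hBs : CMDiffAt ∞ (T% (compB (F := F) φ f B)) x := hf.contMDiffAt_vert hlam hφB
    have hCeq : ∀ y, compC (F := F) φ f B y = hor (F := F) f y (φ y (B y)) := fun y =>
      hf.compC_eq_hor hM.toIsAlmostContactMetric (hB.2 y)
    have hCs : CMDiffAt ∞ (T% (compC (F := F) φ f B)) x := by
      simp only [hCeq]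
      exact hf.contMDiffAt_hor hlam hφB
    have hsum : (fun y => φ y (B y)) =
        fun y => compB (F := F) φ f B y + compC (F := F) φ f B y := funext fun y => by
      rw [hCeq]
      exact (vert_add_hor _).symm
    have hconf := hf.inner_pullbackNabla hlam (hA.1 x) hCs hφVs hA.2
      (fun y => hf.compC_mem hM.toIsAlmostContactMetric (hB.2 y)) hφV
    have hAC : ⟪A x, compC (F := F) φ f B x⟫_ℝ = ⟪A x, φ x (B x)⟫_ℝ := by
      rw [real_inner_comm, hf.inner_compC hM.toIsAlmostContactMetric (hB.2 x) (hA.2 x),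
        real_inner_comm]
    -- Orthogonality of μ and φ(ker f_*) removes the term containing the derivative of ln λ along A.
    rw [inner_compC_phi (hV.2 x), hAC] at hconf
    have hn := hM.nabla_phi A B hA.1 hB.1 x
    rw [hsum, leviCivita_fun_add (hBs.mdifferentiableAt h0) (hCs.mdifferentiableAt h0)] at hn
    have hn' := congrArg (fun v => ⟪v, φ x (V x)⟫_ℝ) hn
    simp only [inner_sub_left, inner_add_left, inner_neg_left, inner_smul_left, conj_trivial]
      at hn'
    rw [inner_oneillA_compB (hA.2 x) (hφV x), hconf, one_div,
      inv_mul_cancel_left₀ (pow_ne_zero 2 (hf.pos x).ne')]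
    linarith
  -- φ preserves inner products with V since η(V) = 0.
  have hbr : ⟪mlieBracket 𝓘(ℝ, E) X Y x, V x⟫_ℝ =
      ⟪φ x (leviCivita Y x (X x)), φ x (V x)⟫_ℝ - ⟪φ x (leviCivita X x (Y x)), φ x (V x)⟫_ℝ := by
    have h := hM.inner_phi_phi x (mlieBracket 𝓘(ℝ, E) X Y x) (V x)
    rw [hf.eta_eq_zero_of_mem_vertSpace hM.toIsAlmostContactMetric (hV.2 x), mul_zero,
      sub_zero] at h
    rw [← h, ← leviCivita_sub_leviCivita ((hX.1 x).mdifferentiableAt h0)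
      ((hY.1 x).mdifferentiableAt h0), map_sub, inner_sub_left]
  have hCXY := hf.inner_compC hM.toIsAlmostContactMetric (hX.2 x) (hY.2 x)
  have hskew := hM.inner_phi_left x (X x) (Y x)
  rw [hbr, key hX hY, key hY hX, hCXY]
  simp only [inner_sub_left, inner_add_left, inner_smul_left, conj_trivial, hgrad]
  rw [real_inner_comm (X x) (Y x), real_inner_comm (φ x (X x)) (Y x), hskew]
  ring

end IsConformalAntiInvariantXiPerpSubmersion

end AntiInvariantSubmersion

/-! ### The equivalence. -/

theorem mainTheorem3
    {E : Type*} [NormedAddCommGroup E] [NormedSpace ℝ E] [FiniteDimensional ℝ E]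
    {M : Type*} [TopologicalSpace M] [T2Space M] [SecondCountableTopology M]
    [ChartedSpace E M] [IsManifold 𝓘(ℝ, E) ∞ M]
    [RiemannianBundle (fun x : M => TangentSpace 𝓘(ℝ, E) x)]
    [IsContMDiffRiemannianBundle 𝓘(ℝ, E) ∞ E (fun x : M => TangentSpace 𝓘(ℝ, E) x)]
    {F : Type*} [NormedAddCommGroup F] [NormedSpace ℝ F] [FiniteDimensional ℝ F]
    {N : Type*} [TopologicalSpace N] [T2Space N] [SecondCountableTopology N]
    [ChartedSpace F N] [IsManifold 𝓘(ℝ, F) ∞ N]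
    [RiemannianBundle (fun y : N => TangentSpace 𝓘(ℝ, F) y)]
    [IsContMDiffRiemannianBundle 𝓘(ℝ, F) ∞ F (fun y : N => TangentSpace 𝓘(ℝ, F) y)]
    (φ : ∀ x : M, TangentSpace 𝓘(ℝ, E) x →L[ℝ] TangentSpace 𝓘(ℝ, E) x)
    (ξ : ∀ x : M, TangentSpace 𝓘(ℝ, E) x)
    (η : ∀ x : M, TangentSpace 𝓘(ℝ, E) x →L[ℝ] ℝ)
    (hM : IsSasakian φ ξ η)
    (f : M → N) (lam : M → ℝ)
    (hf : IsConformalAntiInvariantXiPerpSubmersion (F := F) φ ξ f lam) :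
    HorizontalIntegrable (E := E) (F := F) f ↔
      ∀ X Y V : (∀ x : M, TangentSpace 𝓘(ℝ, E) x),
        IsHorizontalField (F := F) f X → IsHorizontalField (F := F) f Y →
        IsVerticalField (F := F) f V → ∀ x : M,
          (1 / lam x ^ 2) *
            ⟪pullbackNabla (F := F) f (pushField f (compC (F := F) φ f X)) x (Y x)
                - pullbackNabla (F := F) f (pushField f (compC (F := F) φ f Y)) x (X x),
              pushField (F := F) f (fun y => φ y (V y)) x⟫_ℝ
          = ⟪oneillA (F := F) f X (compB (F := F) φ f Y) x
                - oneillA (F := F) f Y (compB (F := F) φ f X) x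
                - dirDeriv (fun y => Real.log (lam y)) x (compC (F := F) φ f Y x) • X x
                + dirDeriv (fun y => Real.log (lam y)) x (compC (F := F) φ f X x) • Y x
                - (2 * ⟪compC (F := F) φ f X x, Y x⟫_ℝ) •
                    riemGrad (fun y => Real.log (lam y)) x
                - η x (Y x) • X x
                + η x (X x) • Y x,
              φ x (V x)⟫_ℝ := by
  have hbr := fun X Y V hX hY hV x =>
    hf.inner_mlieBracket_eq hM (X := X) (Y := Y) (V := V) hX hY hV x
  constructor
  · intro h X Y V hX hY hV x
    have h1 := hbr X Y V hX hY hV x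
    rw [inner_hor_vert (hV.2 x) (h X Y hX hY x)] at h1
    exact (sub_eq_zero.1 h1.symm).symm
  · intro h X Y hX hY x
    -- The vertical part of the bracket is itself an admissible test field, being smooth because 𝓥
    -- preserves smoothness; pairing the bracket with it gives its squared length.
    let V : ∀ y : M, TangentSpace 𝓘(ℝ, E) y :=
      fun y => vert (F := F) f y (mlieBracket 𝓘(ℝ, E) X Y y)
    have hV : IsVerticalField (F := F) f V :=
      ⟨fun y => hf.contMDiffAt_vert (hf.contMDiff_dilation hM.toIsAlmostContactMetric y)
        ((hX.1 y).mlieBracket_infty (hY.1 y)), fun y => vert_mem _⟩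
    have h1 := hbr X Y V hX hY hV x
    rw [← h X Y V hX hY hV x, sub_self] at h1
    have h2 := vert_add_hor (F := F) (f := f) (mlieBracket 𝓘(ℝ, E) X Y x)
    have h3 : ⟪V x, V x⟫_ℝ = 0 := by
      rw [← h2, inner_add_left, inner_hor_vert (hV.2 x) (hor_mem _), add_zero] at h1
      exact h1
    have h4 : V x = 0 :=
      (inner_self_eq_zero (𝕜 := ℝ) (E := TangentSpace 𝓘(ℝ, E) x)).1 h3
    rw [← h2, show vert (F := F) f x _ = 0 from h4, zero_add]
    exact hor_mem _
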